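/- Let $\mathrm{M}$ be a loopless matroid on a finite set $E$. A flat is \emph{proper} if it is not $E$, and a \emph{flag} is a set of flats that is totally ordered by inclusion (possibly empty). \emph{Rings of the matroid.} The Chow ring of $\mathrm{M}$ is $$\underline{\mathrm{CH}}(\mathrm{M})=\mathbb{Q}[x_F \mid F \text{ a nonempty proper flat}]\,/\,(\underline{I}_{\mathrm M}+\underline{J}_{\mathrm M}),$$ where $\underline I_{\mathrm M}$ is generated by $\sum_{i_1\in F}x_F-\sum_{i_2\in F}x_F$ for distinct $i_1,i_2\in E$, and $\underline J_{\mathrm M}$ is generated by $x_{F_1}x_{F_2}$ for incomparable nonempty proper flats $F_1,F_2$. The augmented Chow ring of $\mathrm{M}$ is $$\mathrm{CH}(\mathrm{M})=\mathbb{Q}[y_i,\,x_F \mid i\in E,\ F\text{ a proper flat}]\,/\,(I_{\mathrm M}+J_{\mathrm M}),$$ where $I_{\mathrm M}$ is generated by $y_i-\sum_{i\notin F}x_F$ for $i\in E$, and $J_{\mathrm M}$ is generated by $x_{F_1}x_{F_2}$ for incomparable proper flats $F_1,F_2$ and by $y_ix_F$ for $i\in E$ and proper flats $F\not\ni i$.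 Both are graded by the degree of polynomials. \emph{Fans.} For $S\subseteq E$ put $\mathbf e_S=\sum_{i\in S}\mathbf e_i\in\mathbb R^E$. The Bergman fan $\underline\Pi_{\mathrm M}$ is the unimodular fan in $\mathbb R^E/\langle \mathbf e_E\rangle$ (with lattice $\mathbb Z^E/\langle \mathbf e_E\rangle$) whose cones are $\mathrm{cone}\{\mathbf e_F\}_{F\in\mathscr F}$ for flags $\mathscr F$ of nonempty proper flats. The augmented Bergman fan $\Pi_{\mathrm M}$ is the unimodular fan in $\mathbb R^E$ (with lattice $\mathbb Z^E$) whose cones are $\mathrm{cone}\{\mathbf e_i\}_{i\in I}+\mathrm{cone}\{-\mathbf e_{E\setminus F}\}_{F\in\mathscr F}$, for flags $\mathscr F$ of proper flats and independent sets $I$ contained in every member of $\mathscr F$. \emph{Chow ring of a fan.} For a unimodular fan $\Sigma$, let $\mathrm{CH}(\Sigma)$ be the graded $\mathbb Q$-algebra of continuous functions on the support of $\Sigma$ that restrict on each cone to a polynomial function with rational coefficients (with respect to the lattice), modulo the ideal generated by the globally linear functions with rational coefficients. (By a theorem of Brion this is the rational Chow ring of the smooth complex toric variety of $\Sigma$.)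 The \emph{Courant function} of a ray $\rho$ of $\Sigma$ is the piecewise linear function on $\Sigma$ with value $1$ at the primitive generator of $\rho$ and $0$ at the primitive generators of all other rays. \textbf{Proposition.} There are isomorphisms of graded $\mathbb Q$-algebras $$\underline{\mathrm{CH}}(\mathrm M)\cong \mathrm{CH}(\underline\Pi_{\mathrm M})\qquad\text{and}\qquad \mathrm{CH}(\mathrm M)\cong \mathrm{CH}(\Pi_{\mathrm M}),$$ each carrying every generator to the class of the Courant function of the corresponding ray: $x_F$ corresponds to the ray of $\mathbf e_F$ in $\underline\Pi_{\mathrm M}$ in the first; $y_i$ corresponds to the ray of $\mathbf e_i$ and $x_F$ to the ray of $-\mathbf e_{E\setminus F}$ in $\Pi_{\mathrm M}$ in the second. -/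

import Mathlib

noncomputable section

open scoped Classical

/-! ### The Chow ring of a fan -/

namespace FanChow

variable {V : Type*} [AddCommGroup V] [Module ℝ V]

/-- The real linear functionals on `V` that are rational with respect to the lattice `N`,
as a `ℚ`-subspace of the algebra of real functions on `V`. -/
def ratLinear (N : AddSubgroup V) : Submodule ℚ (V → ℝ) where
  carrier := {f | ∃ l : V →ₗ[ℝ] ℝ, (∀ v ∈ N, ∃ q : ℚ, l v = (q : ℝ)) ∧ f = l}
  zero_mem' := ⟨0, fun _ _ => ⟨0, by simp⟩, by ext; simp⟩
  add_mem' := by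
    rintro _ _ ⟨l, hl, rfl⟩ ⟨m, hm, rfl⟩
    refine ⟨l + m, fun v hv => ?_, by ext; simp⟩
    obtain ⟨q, hq⟩ := hl v hv
    obtain ⟨r, hr⟩ := hm v hv
    exact ⟨q + r, by simp [hq, hr]⟩
  smul_mem' := by
    rintro c _ ⟨l, hl, rfl⟩
    refine ⟨(c : ℝ) • l, fun v hv => ?_, by ext; simp [Rat.smul_def]⟩
    obtain ⟨q, hq⟩ := hl v hv
    exact ⟨c * q, by simp [hq]⟩

/-- The polynomial functions on `V` with rational coefficients with respect to the lattice `N`. -/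
def ratPoly (N : AddSubgroup V) : Subalgebra ℚ (V → ℝ) :=
  Algebra.adjoin ℚ (ratLinear N : Set (V → ℝ))

/-- The support of a fan, given as its set of cones. -/
def support (C : Set (PointedCone ℝ V)) : Set V := {v | ∃ σ ∈ C, v ∈ σ}

variable [TopologicalSpace V]

/-- Continuous piecewise polynomial functions with rational coefficients on a fan: continuous
functions on its support whose restriction to each cone is a rational polynomial function. -/
def piecewisePoly (N : AddSubgroup V) (C : Set (PointedCone ℝ V)) :
    Subalgebra ℚ (support C → ℝ) where
  carrier := {f | Continuous f ∧
    ∀ σ ∈ C, ∃ p ∈ ratPoly N, ∀ v : support C, (v : V) ∈ σ → f v = p v}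
  mul_mem' := by
    rintro f g ⟨hf, hf'⟩ ⟨hg, hg'⟩
    refine ⟨hf.mul hg, fun σ hσ => ?_⟩
    obtain ⟨p, hp, hfp⟩ := hf' σ hσ
    obtain ⟨q, hq, hgq⟩ := hg' σ hσ
    exact ⟨p * q, mul_mem hp hq, fun v hv => by simp [hfp v hv, hgq v hv]⟩
  add_mem' := by
    rintro f g ⟨hf, hf'⟩ ⟨hg, hg'⟩
    refine ⟨hf.add hg, fun σ hσ => ?_⟩
    obtain ⟨p, hp, hfp⟩ := hf' σ hσ
    obtain ⟨q, hq, hgq⟩ := hg' σ hσ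
    exact ⟨p + q, add_mem hp hq, fun v hv => by simp [hfp v hv, hgq v hv]⟩
  algebraMap_mem' := fun r => by
    refine ⟨by exact continuous_const, fun σ _ => ?_⟩
    exact ⟨algebraMap ℚ (V → ℝ) r, (ratPoly N).algebraMap_mem r, fun v _ => rfl⟩

/-- Piecewise polynomial functions that are homogeneous of degree `k` on each cone.
Here `ratLinear N ^ k` is the `ℚ`-span of the products of `k` rational linear functionals. -/
def piecewiseHomogeneous (N : AddSubgroup V) (C : Set (PointedCone ℝ V)) (k : ℕ) :
    Submodule ℚ (piecewisePoly N C) where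
  carrier := {f | ∀ σ ∈ C, ∃ p ∈ ratLinear N ^ k, ∀ v : support C, (v : V) ∈ σ → f.1 v = p v}
  zero_mem' := fun _ _ => ⟨0, zero_mem _, fun _ _ => rfl⟩
  add_mem' := by
    intro f g hf hg σ hσ
    obtain ⟨p, hp, hfp⟩ := hf σ hσ
    obtain ⟨q, hq, hgq⟩ := hg σ hσ
    exact ⟨p + q, add_mem hp hq, fun v hv => by simp [hfp v hv, hgq v hv]⟩
  smul_mem' := by
    intro c f hf σ hσ
    obtain ⟨p, hp, hfp⟩ := hf σ hσ
    exact ⟨c • p, Submodule.smul_mem _ c hp, fun v hv => by simp [hfp v hv]⟩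

/-- The ideal generated by the (restrictions to the support of) globally linear functions. -/
def linearIdeal (N : AddSubgroup V) (C : Set (PointedCone ℝ V)) : Ideal (piecewisePoly N C) :=
  Ideal.span {f | ∃ l ∈ ratLinear N, ∀ v : support C, f.1 v = l v}

/-- The Chow ring `CH(Σ)` of a unimodular fan `Σ` (given as its set of cones), with rational
coefficients: continuous piecewise polynomial functions modulo globally linear functions. -/
abbrev ChowRing (N : AddSubgroup V) (C : Set (PointedCone ℝ V)) : Type _ :=
  piecewisePoly N C ⧸ linearIdeal N C

/-- The quotient map from piecewise polynomial functions to the Chow ring of a fan. -/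
def toChow (N : AddSubgroup V) (C : Set (PointedCone ℝ V)) :
    piecewisePoly N C →ₐ[ℚ] ChowRing N C :=
  Ideal.Quotient.mkₐ ℚ (linearIdeal N C)

/-- The graded piece `CH^k(Σ)`. -/
def gradedPiece (N : AddSubgroup V) (C : Set (PointedCone ℝ V)) (k : ℕ) :
    Submodule ℚ (ChowRing N C) :=
  (piecewiseHomogeneous N C k).map (toChow N C).toLinearMap

/-- `f` is the Courant function of the ray `j`, where `u` lists the ray generators of the fan:
it is piecewise linear, takes value `1` at `u j` and value `0` at all other ray generators. -/
def IsCourant (N : AddSubgroup V) (C : Set (PointedCone ℝ V)) {ι : Type*} (u : ι → V) (j : ι)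
    (f : piecewisePoly N C) : Prop :=
  f ∈ piecewiseHomogeneous N C 1 ∧
    ∀ (i : ι) (v : support C), (v : V) = u i → f.1 v = if i = j then 1 else 0

end FanChow

namespace MatroidChow

variable {α : Type*} (M : Matroid α)

/-- Proper flats of `M`. -/
abbrev ProperFlat : Type _ := {F : Set α // M.IsFlat F ∧ F ≠ M.E}

/-- Nonempty proper flats of `M`. -/
abbrev NonemptyProperFlat : Type _ := {F : Set α // M.IsFlat F ∧ F ≠ M.E ∧ F.Nonempty}

theorem finite_flats [M.Finite] : {F : Set α | M.IsFlat F}.Finite :=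
  (M.ground_finite.finite_subsets).subset fun _ hF => hF.subset_ground

instance [M.Finite] : Fintype (ProperFlat M) :=
  ((finite_flats M).subset fun _ hF => hF.1).fintype

instance [M.Finite] : Fintype (NonemptyProperFlat M) :=
  ((finite_flats M).subset fun _ hF => hF.1).fintype

section Rings

open MvPolynomial

/-! ### The Chow ring of a matroid -/

/-- The ideal of linear relations `∑_{i₁ ∈ F} x_F - ∑_{i₂ ∈ F} x_F`. -/
def chowI [M.Finite] : Ideal (MvPolynomial (NonemptyProperFlat M) ℚ) :=
  Ideal.span {p | ∃ i₁ ∈ M.E, ∃ i₂ ∈ M.E, i₁ ≠ i₂ ∧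
    p = ∑ F : NonemptyProperFlat M with i₁ ∈ F.1, X F
      - ∑ F : NonemptyProperFlat M with i₂ ∈ F.1, X F}

/-- The ideal generated by `x_{F₁} x_{F₂}` for incomparable `F₁`, `F₂`. -/
def chowJ : Ideal (MvPolynomial (NonemptyProperFlat M) ℚ) :=
  Ideal.span {p | ∃ F₁ F₂ : NonemptyProperFlat M,
    ¬ F₁.1 ⊆ F₂.1 ∧ ¬ F₂.1 ⊆ F₁.1 ∧ p = X F₁ * X F₂}

/-- The Chow ring of `M`. -/
abbrev ChowRing [M.Finite] : Type _ :=
  MvPolynomial (NonemptyProperFlat M) ℚ ⧸ (chowI M ⊔ chowJ M)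

/-- The quotient map onto the Chow ring of `M`. -/
def toChow [M.Finite] : MvPolynomial (NonemptyProperFlat M) ℚ →ₐ[ℚ] ChowRing M :=
  Ideal.Quotient.mkₐ ℚ (chowI M ⊔ chowJ M)

/-- The degree `k` piece of the Chow ring of `M`. -/
def chowPiece [M.Finite] (k : ℕ) : Submodule ℚ (ChowRing M) :=
  (homogeneousSubmodule (NonemptyProperFlat M) ℚ k).map (toChow M).toLinearMap

/-! ### The augmented Chow ring of a matroid

The variable `y_i` is `X (Sum.inl i)` and the variable `x_F` is `X (Sum.inr F)`. -/

/-- The ideal of linear relations `y_i - ∑_{i ∉ F} x_F`. -/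
def augChowI [M.Finite] : Ideal (MvPolynomial (M.E ⊕ ProperFlat M) ℚ) :=
  Ideal.span {p | ∃ i : M.E,
    p = X (Sum.inl i) - ∑ F : ProperFlat M with (i : α) ∉ F.1, X (Sum.inr F)}

/-- The ideal generated by `x_{F₁} x_{F₂}` for incomparable `F₁`, `F₂` and by `y_i x_F` for
`i ∉ F`. -/
def augChowJ : Ideal (MvPolynomial (M.E ⊕ ProperFlat M) ℚ) :=
  Ideal.span ({p | ∃ F₁ F₂ : ProperFlat M,
      ¬ F₁.1 ⊆ F₂.1 ∧ ¬ F₂.1 ⊆ F₁.1 ∧ p = X (Sum.inr F₁) * X (Sum.inr F₂)} ∪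
    {p | ∃ (i : M.E) (F : ProperFlat M),
      (i : α) ∉ F.1 ∧ p = X (Sum.inl i) * X (Sum.inr F)})

/-- The augmented Chow ring of `M`. -/
abbrev AugChowRing [M.Finite] : Type _ :=
  MvPolynomial (M.E ⊕ ProperFlat M) ℚ ⧸ (augChowI M ⊔ augChowJ M)

/-- The quotient map onto the augmented Chow ring of `M`. -/
def toAugChow [M.Finite] : MvPolynomial (M.E ⊕ ProperFlat M) ℚ →ₐ[ℚ] AugChowRing M :=
  Ideal.Quotient.mkₐ ℚ (augChowI M ⊔ augChowJ M)

/-- The degree `k` piece of the augmented Chow ring of `M`. -/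
def augChowPiece [M.Finite] (k : ℕ) : Submodule ℚ (AugChowRing M) :=
  (homogeneousSubmodule (M.E ⊕ ProperFlat M) ℚ k).map (toAugChow M).toLinearMap

end Rings

/-! ### The two fans -/

/-- The vector `e_S ∈ ℝ^E`, the sum of the standard basis vectors `e_i` for `i ∈ S`. -/
def e (S : Set α) : M.E → ℝ := fun i => if (i : α) ∈ S then 1 else 0

/-- The lattice `ℤ^E` in `ℝ^E`. -/
def lattice : AddSubgroup (M.E → ℝ) :=
  AddSubgroup.pi Set.univ fun _ => (Int.castAddHom ℝ).range

/-- The ray generators of the augmented Bergman fan: `e_i` for `i ∈ E`, and `-e_{E \ F}` for a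
proper flat `F`. -/
def augRay : M.E ⊕ ProperFlat M → (M.E → ℝ) :=
  Sum.elim (fun i => e M {(i : α)}) (fun F => - e M (M.E \ F.1))

/-- The cone `σ_{I ≤ 𝓕}`. -/
def augCone (I : Set α) (𝓕 : Set (ProperFlat M)) : PointedCone ℝ (M.E → ℝ) :=
  PointedCone.hull ℝ ({v | ∃ i : M.E, (i : α) ∈ I ∧ v = augRay M (Sum.inl i)} ∪
    {v | ∃ F ∈ 𝓕, v = augRay M (Sum.inr F)})

/-- The augmented Bergman fan of `M`, as the set of its cones `σ_{I ≤ 𝓕}`, for `I` an independent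
set and `𝓕` a flag of proper flats such that `I` is contained in every member of `𝓕`. -/
def augBergmanFan : Set (PointedCone ℝ (M.E → ℝ)) :=
  {σ | ∃ (I : Set α) (𝓕 : Set (ProperFlat M)), M.Indep I ∧ IsChain (· ≤ ·) 𝓕 ∧
    (∀ F ∈ 𝓕, I ⊆ F.1) ∧ σ = augCone M I 𝓕}

/-- The quotient space `ℝ^E / ⟨e_E⟩`. -/
abbrev QuotSpace : Type _ := (M.E → ℝ) ⧸ Submodule.span ℝ {e M M.E}

/-- The quotient lattice `ℤ^E / ⟨e_E⟩` in `ℝ^E / ⟨e_E⟩`. -/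
def quotLattice : AddSubgroup (QuotSpace M) :=
  (lattice M).map (Submodule.mkQ (Submodule.span ℝ {e M M.E})).toAddMonoidHom

/-- The ray generators of the Bergman fan: the classes of `e_F`, for nonempty proper flats `F`. -/
def ray (F : NonemptyProperFlat M) : QuotSpace M := Submodule.Quotient.mk (e M F.1)

/-- The Bergman fan of `M`, as the set of its cones `cone {e_F}_{F ∈ 𝓕}`, for `𝓕` a flag of
nonempty proper flats. -/
def bergmanFan : Set (PointedCone ℝ (QuotSpace M)) :=
  {σ | ∃ 𝓕 : Set (NonemptyProperFlat M), IsChain (· ≤ ·) 𝓕 ∧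
    σ = PointedCone.hull ℝ (ray M '' 𝓕)}

end MatroidChow

end

/-! ### Polynomials and the supports of their monomials -/

noncomputable section

open scoped Classical

namespace MvPolynomial

variable {ι : Type*}

/-! Both isomorphisms come from one presentation of the Chow ring of a unimodular fan with rays `u
i` and simplicial complex `Δ`. Every point of the support has unique nonnegative coordinates along
the rays of a cone containing it, and these coordinates are the Courant functions. Sending `X i` to
the `i`-th Courant function is surjective onto piecewise polynomials: the coefficient of a monomial
`m` is read off on the cone spanned by the support of `m`, and the choices agree because a
polynomial vanishing on an orthant is zero. The same remark shows that the kernel consists of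
combinations of monomials with support outside `Δ`, the Stanley–Reisner ideal. A global linear
function `l` is the image of `∑ l (u i) X i`, so the Chow ring is the polynomial ring modulo the
Stanley–Reisner and linear relations (`IsUnimodular.exists_chowRing_equiv`). Of unimodularity, the
argument needs only rational dual functionals on each cone, and that two expressions of the same
point lie over a common cone.

For a matroid it remains to verify these conditions and to match the ideals. Functionals dual to a
flag are built from coordinates at points separating consecutive flats. For the Bergman fan,
functionals killing `e_E` have coefficients of sum zero, hence are combinations of differences of
coordinates. In the augmented case the complex also excludes dependent sets, although `augChowJ` has
no generator for them; their monomials are zero only modulo the linear relations. This is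
`prod_mem_augChow_of_notMem`: if `i` lies in the closure of the rest of the set, rewriting `y_i` as
the sum of `x_F` over `F` not containing `i` leaves only terms divisible by some `y_j x_F` with `j ∉
F`. -/

theorem exists_coeff_eq_ite (P : MvPolynomial ι ℚ) (p : (ι →₀ ℕ) → Prop) :
    ∃ Q : MvPolynomial ι ℚ, ∀ m, Q.coeff m = if p m then P.coeff m else 0 := by
  refine ⟨∑ m ∈ P.support with p m, monomial m (P.coeff m), fun m => ?_⟩
  simp only [coeff_sum, coeff_monomial, Finset.sum_ite_eq', Finset.mem_filter, mem_support_iff]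
  by_cases h : P.coeff m = 0 <;> simp [h]

/-- Polynomials indexed by sets of variables can be glued along the supports of monomials. -/
theorem exists_coeff_eq_of_support [Finite ι] (P : Finset ι → MvPolynomial ι ℚ)
    (Δ : Set (Finset ι)) : ∃ Q : MvPolynomial ι ℚ, ∀ m : ι →₀ ℕ,
      Q.coeff m = if m.support ∈ Δ then (P m.support).coeff m else 0 := by
  have := Fintype.ofFinite ι
  choose R hR using fun t : Finset ι => (P t).exists_coeff_eq_ite (fun m => m.support = t ∧ t ∈ Δ)
  refine ⟨∑ t, R t, fun m => ?_⟩
  simp only [coeff_sum, hR]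
  rw [Finset.sum_eq_single m.support]
  · simp
  · intro t _ ht
    simp [Ne.symm ht]
  · simp

/-- On the coordinate subspace of `s`, every monomial involving another variable vanishes. -/
theorem aeval_eq_zero_of_coeff {P : MvPolynomial ι ℚ} {a : ι → ℝ} {s : Finset ι}
    (ha : ∀ i ∉ s, a i = 0) (h : ∀ m : ι →₀ ℕ, m.support ⊆ s → P.coeff m = 0) :
    aeval a P = 0 := by
  rw [aeval_def, eval₂_eq]
  refine Finset.sum_eq_zero fun m _ => ?_
  by_cases hm : m.support ⊆ s
  · simp [h m hm]
  · obtain ⟨i, him, his⟩ := Finset.not_subset.1 hm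
    rw [Finset.prod_eq_zero him, mul_zero]
    rw [ha i his, zero_pow (Finsupp.mem_support_iff.1 him)]

/-- The part of `P` in the variables of `s` vanishes at all nonnegative rational points, and a
polynomial vanishing on a product of infinite sets is zero. -/
theorem coeff_eq_zero_of_aeval {P : MvPolynomial ι ℚ} {s : Finset ι}
    (h : ∀ a : ι → ℝ, (∀ i, 0 ≤ a i) → (∀ i ∉ s, a i = 0) → aeval a P = 0)
    {m : ι →₀ ℕ} (hm : m.support ⊆ s) : P.coeff m = 0 := by
  obtain ⟨Q, hQ⟩ := P.exists_coeff_eq_ite (fun m => m.support ⊆ s)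
  suffices hQ0 : Q = 0 by simpa [hQ0, hm] using (hQ m).symm
  refine funext_set (fun _ => Set.Ici (0 : ℚ)) (fun _ => Set.Ici_infinite 0) fun x hx => ?_
  set y : ι → ℝ := fun i => if i ∈ s then (x i : ℝ) else 0 with hy
  have hPy : aeval y P = 0 := by
    refine h y (fun i => ?_) (fun i hi => by simp [hy, hi])
    by_cases hi : i ∈ s
    · simpa [hy, hi] using hx i trivial
    · simp [hy, hi]
  have hQy : aeval y Q = 0 := by
    have : aeval y (P - Q) = 0 :=
      aeval_eq_zero_of_coeff (s := s) (fun i hi => by simp [hy, hi])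
        (fun m hm => by simp [hQ, hm])
    rwa [map_sub, hPy, zero_sub, neg_eq_zero] at this
  have hQx : aeval y Q = ((eval x Q : ℚ) : ℝ) := by
    rw [aeval_def, eval₂_eq, eval_eq, Rat.cast_sum]
    refine Finset.sum_congr rfl fun m hm => ?_
    have hms : m.support ⊆ s := by
      by_contra hms
      exact (mem_support_iff.1 hm) (by simp [hQ, hms])
    rw [Rat.cast_mul, Rat.cast_prod]
    congr 1
    refine Finset.prod_congr rfl fun i hi => ?_
    simp [hy, hms hi]
  rw [hQy] at hQx
  simpa using hQx.symm

/-- Each monomial is divisible by the squarefree product over its support. -/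
theorem mem_ideal_of_support {P : MvPolynomial ι ℚ} {Δ : Set (Finset ι)}
    {K : Ideal (MvPolynomial ι ℚ)} (hK : ∀ s ∉ Δ, ∏ i ∈ s, X i ∈ K)
    (h : ∀ m : ι →₀ ℕ, m.support ∈ Δ → P.coeff m = 0) : P ∈ K := by
  rw [P.as_sum]
  refine sum_mem fun m hm => ?_
  have hmΔ : m.support ∉ Δ := fun hmΔ => (mem_support_iff.1 hm) (h m hmΔ)
  rw [monomial_eq]
  refine K.mul_mem_left _ (Ideal.mem_of_dvd K ?_ (hK _ hmΔ))
  refine Finset.prod_dvd_prod_of_dvd _ _ fun i hi => dvd_pow_self _ (Finsupp.mem_support_iff.1 hi)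

end MvPolynomial

end

/-! ### Piecewise polynomials on a unimodular fan -/

noncomputable section

open scoped Classical

namespace FanChow

open MvPolynomial

variable {V : Type*} [AddCommGroup V] [Module ℝ V] {ι : Type*} [Fintype ι]

/-- The cones spanned by the rays `u i`, for `i` in a member of `Δ`. -/
def fanOf (u : ι → V) (Δ : Set (Finset ι)) : Set (PointedCone ℝ V) :=
  {σ | ∃ s ∈ Δ, σ = PointedCone.hull ℝ (u '' s)}

/-- The nonnegative coordinate vectors supported on a member of `Δ`. -/
def coordVectors (Δ : Set (Finset ι)) : Set (ι → ℝ) :=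
  {a | (∀ i, 0 ≤ a i) ∧ ∃ s ∈ Δ, ∀ i ∉ s, a i = 0}

/-- The rays `u i` span a unimodular fan with underlying simplicial complex `Δ`. -/
structure IsUnimodular (N : AddSubgroup V) (u : ι → V) (Δ : Set (Finset ι)) : Prop where
  subset_mem : ∀ s ∈ Δ, ∀ t ⊆ s, t ∈ Δ
  singleton_mem : ∀ i, {i} ∈ Δ
  ray_mem : ∀ i, u i ∈ N
  exists_dual : ∀ s ∈ Δ, ∀ i ∈ s, ∃ l : V →ₗ[ℝ] ℝ, (∀ v ∈ N, ∃ q : ℚ, l v = (q : ℝ)) ∧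
    ∀ j ∈ s, l (u j) = if j = i then 1 else 0
  exists_common : ∀ a ∈ coordVectors Δ, ∀ b ∈ coordVectors Δ,
    ∑ i, a i • u i = ∑ i, b i • u i → ∃ s ∈ Δ, ∀ i ∉ s, a i = 0 ∧ b i = 0

theorem mem_hull_image_iff {u : ι → V} {s : Finset ι} {v : V} :
    v ∈ PointedCone.hull ℝ (u '' s) ↔
      ∃ a : ι → ℝ, (∀ i, 0 ≤ a i) ∧ (∀ i ∉ s, a i = 0) ∧ v = ∑ i, a i • u i := by
  constructor
  · intro hv
    induction hv using Submodule.span_induction with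
    | mem x hx =>
      obtain ⟨i, hi, rfl⟩ := hx
      refine ⟨Pi.single i 1, fun j => ?_, fun j hj => ?_, ?_⟩
      · by_cases h : j = i <;> simp [h]
      · exact Pi.single_eq_of_ne (by rintro rfl; exact hj hi) _
      · simp [Pi.single_apply]
    | zero => exact ⟨0, by simp, by simp, by simp⟩
    | add x y _ _ hx hy =>
      obtain ⟨a, ha, ha', rfl⟩ := hx
      obtain ⟨b, hb, hb', rfl⟩ := hy
      exact ⟨a + b, fun i => add_nonneg (ha i) (hb i), fun i hi => by simp [ha' i hi, hb' i hi],
        by simp [add_smul, Finset.sum_add_distrib]⟩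
    | smul c x _ hx =>
      obtain ⟨a, ha, ha', rfl⟩ := hx
      refine ⟨(c : ℝ) • a, fun i => mul_nonneg c.2 (ha i), fun i hi => by simp [ha' i hi], ?_⟩
      simp only [Pi.smul_apply, smul_eq_mul, mul_smul, ← Finset.smul_sum]
      rfl
  · rintro ⟨a, ha, ha', rfl⟩
    refine sum_mem fun i _ => ?_
    by_cases hi : i ∈ s
    · exact Submodule.smul_mem _ (⟨a i, ha i⟩ : {c : ℝ // 0 ≤ c})
        (Submodule.subset_span ⟨i, hi, rfl⟩)
    · simp [ha' i hi]

theorem mem_support_iff {u : ι → V} {Δ : Set (Finset ι)} {v : V} :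
    v ∈ support (fanOf u Δ) ↔ ∃ a ∈ coordVectors Δ, v = ∑ i, a i • u i := by
  constructor
  · rintro ⟨_, ⟨s, hs, rfl⟩, hv⟩
    obtain ⟨a, ha, ha', h⟩ := mem_hull_image_iff.1 hv
    exact ⟨a, ⟨ha, s, hs, ha'⟩, h⟩
  · rintro ⟨a, ⟨ha, s, hs, ha'⟩, h⟩
    exact ⟨_, ⟨s, hs, rfl⟩, mem_hull_image_iff.2 ⟨a, ha, ha', h⟩⟩

/-- The coefficients are the values at the rays, rational because the rays lie in the lattice. -/
theorem exists_linear_form {N : AddSubgroup V} {u : ι → V} (hu : ∀ i, u i ∈ N) {f : V → ℝ}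
    (hf : f ∈ ratLinear N) : ∃ q : ι → ℚ, (∀ i, (q i : ℝ) = f (u i)) ∧
      ∀ a : ι → ℝ, f (∑ i, a i • u i) = aeval a (∑ i, C (q i) * X i) := by
  obtain ⟨l, hl, rfl⟩ := hf
  choose q hq using fun i => hl (u i) (hu i)
  refine ⟨q, fun i => (hq i).symm, fun a => ?_⟩
  simp [hq, mul_comm]

theorem isHomogeneous_linear_form (q : ι → ℚ) : (∑ i, C (q i) * X i).IsHomogeneous 1 :=
  IsHomogeneous.sum _ _ _ fun i _ => by
    simpa using (isHomogeneous_C ι (q i)).mul (isHomogeneous_X ℚ i)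

theorem exists_poly_of_ratPoly {N : AddSubgroup V} {u : ι → V} (hu : ∀ i, u i ∈ N) {f : V → ℝ}
    (hf : f ∈ ratPoly N) :
    ∃ P : MvPolynomial ι ℚ, ∀ a : ι → ℝ, f (∑ i, a i • u i) = aeval a P := by
  induction hf using Algebra.adjoin_induction with
  | mem f hf =>
    obtain ⟨q, -, hq⟩ := exists_linear_form hu hf
    exact ⟨_, hq⟩
  | algebraMap r => exact ⟨C r, fun a => by simp⟩
  | add f g _ _ hf hg =>
    obtain ⟨P, hP⟩ := hf
    obtain ⟨Q, hQ⟩ := hg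
    exact ⟨P + Q, fun a => by simp [hP, hQ]⟩
  | mul f g _ _ hf hg =>
    obtain ⟨P, hP⟩ := hf
    obtain ⟨Q, hQ⟩ := hg
    exact ⟨P * Q, fun a => by simp [hP, hQ]⟩

theorem exists_poly_of_ratLinear_pow {N : AddSubgroup V} {u : ι → V} (hu : ∀ i, u i ∈ N)
    {f : V → ℝ} {k : ℕ} (hf : f ∈ ratLinear N ^ k) :
    ∃ P : MvPolynomial ι ℚ, P.IsHomogeneous k ∧
      ∀ a : ι → ℝ, f (∑ i, a i • u i) = aeval a P := by
  induction hf using Submodule.pow_induction_on_left' with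
  | algebraMap r => exact ⟨C r, isHomogeneous_C _ _, fun a => by simp⟩
  | add f g k _ _ hf hg =>
    obtain ⟨P, hP, hP'⟩ := hf
    obtain ⟨Q, hQ, hQ'⟩ := hg
    exact ⟨P + Q, hP.add hQ, fun a => by simp [hP', hQ']⟩
  | mem_mul l hl k f _ hf =>
    obtain ⟨P, hP, hP'⟩ := hf
    obtain ⟨q, -, hq⟩ := exists_linear_form hu hl
    refine ⟨_, ?_, fun a => by rw [Pi.mul_apply, hq, hP', ← map_mul]⟩
    rw [Nat.succ_eq_add_one, add_comm]
    exact (isHomogeneous_linear_form q).mul hP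

theorem mul_mem_submodule_pow_add {R A : Type*} [CommSemiring R] [Semiring A] [Algebra R A]
    {S : Submodule R A} {m n : ℕ} {x y : A} (hx : x ∈ S ^ m) (hy : y ∈ S ^ n) :
    x * y ∈ S ^ (m + n) := by
  have hxy := Submodule.mul_mem_mul hx hy
  rcases eq_or_ne n 0 with rfl | hn
  · rwa [Submodule.pow_zero, Submodule.mul_one] at hxy
  · rwa [Submodule.pow_add _ hn]

theorem aeval_mem_ratLinear_pow {κ : Type*} {N : AddSubgroup V} {f : κ → V → ℝ}
    (hf : ∀ i, f i ∈ ratLinear N) {k : ℕ} {P : MvPolynomial κ ℚ} (hP : P.IsHomogeneous k) :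
    aeval f P ∈ ratLinear N ^ k := by
  rw [aeval_def, eval₂_eq]
  refine sum_mem fun m hm => ?_
  rw [← Algebra.smul_def]
  refine Submodule.smul_mem _ _ ?_
  rw [hP.degree_eq_sum_deg_support hm]
  induction m.support using Finset.induction_on with
  | empty => simp
  | insert i s hi ih =>
    rw [Finset.prod_insert hi, Finset.sum_insert hi]
    exact mul_mem_submodule_pow_add (Submodule.pow_mem_pow _ (hf i) _) ih

variable {N : AddSubgroup V} {u : ι → V} {Δ : Set (Finset ι)}

namespace IsUnimodular

/-- Over a common cone, the dual functionals recover the coordinates from the point. -/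
theorem coord_unique (h : IsUnimodular N u Δ) {a b : ι → ℝ} (ha : a ∈ coordVectors Δ)
    (hb : b ∈ coordVectors Δ) (hab : ∑ i, a i • u i = ∑ i, b i • u i) : a = b := by
  obtain ⟨s, hs, hs'⟩ := h.exists_common a ha b hb hab
  funext j
  by_cases hj : j ∈ s
  · obtain ⟨l, -, hl⟩ := h.exists_dual s hs j hj
    have key : ∀ c : ι → ℝ, (∀ i ∉ s, c i = 0) → l (∑ i, c i • u i) = c j := by
      intro c hc
      rw [map_sum, Finset.sum_eq_single j]
      · simp [hl j hj]
      · intro i _ hij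
        by_cases his : i ∈ s
        · simp [hl i his, hij]
        · simp [hc i his]
      · simp
    rw [← key a fun i hi => (hs' i hi).1, ← key b fun i hi => (hs' i hi).2, hab]
  · rw [(hs' j hj).1, (hs' j hj).2]

/-- The coordinates of a point of the fan with respect to the rays of a cone containing it. -/
def coord (_h : IsUnimodular N u Δ) (v : support (fanOf u Δ)) : ι → ℝ :=
  (mem_support_iff.1 v.2).choose

theorem coord_mem (h : IsUnimodular N u Δ) (v : support (fanOf u Δ)) :
    h.coord v ∈ coordVectors Δ := (mem_support_iff.1 v.2).choose_spec.1

theorem sum_coord (h : IsUnimodular N u Δ) (v : support (fanOf u Δ)) :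
    ∑ i, h.coord v i • u i = v := (mem_support_iff.1 v.2).choose_spec.2.symm

theorem coord_eq (h : IsUnimodular N u Δ) (v : support (fanOf u Δ)) {a : ι → ℝ}
    (ha : a ∈ coordVectors Δ) (hv : (v : V) = ∑ i, a i • u i) : h.coord v = a :=
  h.coord_unique (h.coord_mem v) ha (by rw [h.sum_coord, hv])

theorem coord_eq_zero (h : IsUnimodular N u Δ) {s : Finset ι} (hs : s ∈ Δ)
    {v : support (fanOf u Δ)} (hv : (v : V) ∈ PointedCone.hull ℝ (u '' s)) {i : ι} (hi : i ∉ s) :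
    h.coord v i = 0 := by
  obtain ⟨a, ha, ha', hva⟩ := mem_hull_image_iff.1 hv
  rw [h.coord_eq v ⟨ha, s, hs, ha'⟩ hva, ha' i hi]

/-- On each cone, the coordinates are restrictions of rational functionals. -/
theorem exists_coord_functional (h : IsUnimodular N u Δ) {s : Finset ι} (hs : s ∈ Δ) (j : ι) :
    ∃ l : V →ₗ[ℝ] ℝ, (∀ v ∈ N, ∃ q : ℚ, l v = (q : ℝ)) ∧
      (∀ a : ι → ℝ, (∀ i ∉ s, a i = 0) → l (∑ i, a i • u i) = a j) := by
  by_cases hj : j ∈ s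
  · obtain ⟨l, hlN, hl⟩ := h.exists_dual s hs j hj
    refine ⟨l, hlN, fun a ha => ?_⟩
    rw [map_sum, Finset.sum_eq_single j]
    · simp [hl j hj]
    · intro i _ hij
      by_cases his : i ∈ s
      · simp [hl i his, hij]
      · simp [ha i his]
    · simp
  · exact ⟨0, fun _ _ => ⟨0, by simp⟩, fun a ha => by simp [ha j hj]⟩

/-- The rational functional agreeing with the `j`-th coordinate on the cone of `s`. -/
def functional (h : IsUnimodular N u Δ) {s : Finset ι} (hs : s ∈ Δ) (j : ι) : V →ₗ[ℝ] ℝ :=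
  (h.exists_coord_functional hs j).choose

theorem functional_mem (h : IsUnimodular N u Δ) {s : Finset ι} (hs : s ∈ Δ) (j : ι) :
    (h.functional hs j : V → ℝ) ∈ ratLinear N :=
  ⟨_, (h.exists_coord_functional hs j).choose_spec.1, rfl⟩

theorem functional_sum (h : IsUnimodular N u Δ) {s : Finset ι} (hs : s ∈ Δ) (j : ι)
    {a : ι → ℝ} (ha : ∀ i ∉ s, a i = 0) : h.functional hs j (∑ i, a i • u i) = a j :=
  (h.exists_coord_functional hs j).choose_spec.2 a ha

theorem coord_eq_functional (h : IsUnimodular N u Δ) {s : Finset ι} (hs : s ∈ Δ) (j : ι)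
    {v : support (fanOf u Δ)} (hv : (v : V) ∈ PointedCone.hull ℝ (u '' s)) :
    h.coord v j = h.functional hs j v := by
  conv_rhs => rw [← h.sum_coord v]
  rw [h.functional_sum hs j fun i hi => h.coord_eq_zero hs hv hi]

/-- Cuts the cone out by finitely many closed linear conditions, which makes it closed. -/
theorem mem_hull_iff_functional (h : IsUnimodular N u Δ) {s : Finset ι} (hs : s ∈ Δ) (v : V) :
    v ∈ PointedCone.hull ℝ (u '' s) ↔
      (∀ i, 0 ≤ h.functional hs i v) ∧ (∀ i ∉ s, h.functional hs i v = 0) ∧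
        v = ∑ i, h.functional hs i v • u i := by
  refine ⟨fun hv => ?_, fun hv => mem_hull_image_iff.2 ⟨_, hv⟩⟩
  obtain ⟨a, ha, ha', rfl⟩ := mem_hull_image_iff.1 hv
  simp only [h.functional_sum hs _ ha']
  exact ⟨ha, ha', trivial⟩

variable [TopologicalSpace V] [IsTopologicalAddGroup V] [ContinuousSMul ℝ V] [T2Space V]
  [FiniteDimensional ℝ V]

theorem isClosed_hull (h : IsUnimodular N u Δ) {s : Finset ι} (hs : s ∈ Δ) :
    IsClosed (PointedCone.hull ℝ (u '' s) : Set V) := by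
  have hc : ∀ i, Continuous (h.functional hs i) := fun i =>
    (h.functional hs i).continuous_of_finiteDimensional
  have : (PointedCone.hull ℝ (u '' s) : Set V) =
      {v | (∀ i, 0 ≤ h.functional hs i v) ∧ (∀ i ∉ s, h.functional hs i v = 0) ∧
        v = ∑ i, h.functional hs i v • u i} := by
    ext v
    exact h.mem_hull_iff_functional hs v
  rw [this]
  refine IsClosed.inter ?_ (IsClosed.inter ?_ ?_)
  · change IsClosed {v | ∀ i, 0 ≤ h.functional hs i v}
    rw [Set.ofPred_forall]
    exact isClosed_iInter fun i => isClosed_le continuous_const (hc i)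
  · change IsClosed {v | ∀ i, i ∉ s → h.functional hs i v = 0}
    simp_rw [Set.ofPred_forall]
    exact isClosed_iInter fun i => isClosed_iInter fun _ => isClosed_eq (hc i) continuous_const
  · exact isClosed_eq continuous_id
      (continuous_finsetSum _ fun i _ => (hc i).smul continuous_const)

/-- The support is a finite union of closed cones, on each of which the coordinate is a linear
functional. -/
theorem continuous_coord (h : IsUnimodular N u Δ) (j : ι) : Continuous fun v => h.coord v j := by
  refine (locallyFinite_of_finite (fun s : Δ => {v : support (fanOf u Δ) |
    (v : V) ∈ PointedCone.hull ℝ (u '' (s : Finset ι))})).continuous ?_ (fun s => ?_) fun s => ?_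
  · refine Set.eq_univ_of_forall fun v => ?_
    obtain ⟨_, ⟨s, hs, rfl⟩, hv⟩ := v.2
    exact Set.mem_iUnion.2 ⟨⟨s, hs⟩, hv⟩
  · exact (h.isClosed_hull s.2).preimage continuous_subtype_val
  · refine ContinuousOn.congr (f := fun v : support (fanOf u Δ) => h.functional s.2 j v) ?_
      fun v hv => h.coord_eq_functional s.2 j hv
    exact ((h.functional s.2 j).continuous_of_finiteDimensional.comp
      continuous_subtype_val).continuousOn

/-- The Courant function of a ray. -/
def courant (h : IsUnimodular N u Δ) (j : ι) : piecewisePoly N (fanOf u Δ) :=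
  ⟨fun v => h.coord v j, h.continuous_coord j, by
    rintro _ ⟨s, hs, rfl⟩
    exact ⟨_, Algebra.subset_adjoin (h.functional_mem hs j),
      fun v hv => h.coord_eq_functional hs j hv⟩⟩

/-- Polynomials in the Courant functions. -/
def polyMap (h : IsUnimodular N u Δ) : MvPolynomial ι ℚ →ₐ[ℚ] piecewisePoly N (fanOf u Δ) :=
  aeval h.courant

theorem polyMap_apply (h : IsUnimodular N u Δ) (P : MvPolynomial ι ℚ)
    (v : support (fanOf u Δ)) : (h.polyMap P).1 v = aeval (h.coord v) P :=
  DFunLike.congr_fun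
    (comp_aeval h.courant ((Pi.evalAlgHom ℚ (fun _ => ℝ) v).comp (Subalgebra.val _))) P

theorem polyMap_X (h : IsUnimodular N u Δ) (j : ι) : h.polyMap (X j) = h.courant j :=
  aeval_X _ _

theorem polyMap_mem_piecewiseHomogeneous (h : IsUnimodular N u Δ) {P : MvPolynomial ι ℚ} {k : ℕ}
    (hP : P.IsHomogeneous k) : h.polyMap P ∈ piecewiseHomogeneous N (fanOf u Δ) k := by
  rintro _ ⟨s, hs, rfl⟩
  refine ⟨_, aeval_mem_ratLinear_pow (h.functional_mem hs) hP, fun v hv => ?_⟩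
  rw [h.polyMap_apply]
  have := DFunLike.congr_fun (comp_aeval (fun j => (h.functional hs j : V → ℝ))
    (Pi.evalAlgHom ℚ (fun _ => ℝ) (v : V))) P
  refine Eq.trans ?_ this.symm
  congr 2
  funext j
  exact h.coord_eq_functional hs j hv

theorem isCourant_courant (h : IsUnimodular N u Δ) (j : ι) :
    IsCourant N (fanOf u Δ) u j (h.courant j) := by
  refine ⟨?_, fun i v hv => ?_⟩
  · rw [← h.polyMap_X]
    exact h.polyMap_mem_piecewiseHomogeneous (isHomogeneous_X ℚ j)
  · have : h.coord v = Pi.single i 1 := by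
      refine h.coord_eq v ⟨fun k => ?_, {i}, h.singleton_mem i, fun k hk => ?_⟩ ?_
      · by_cases hk : k = i <;> simp [hk]
      · simp [Finset.mem_singleton.not.1 hk]
      · simp [Pi.single_apply, hv]
    change h.coord v j = _
    simp [this, Pi.single_apply, eq_comm]

/-- A function that agrees with a polynomial in the coordinates on each cone is a polynomial in
the Courant functions. -/
theorem exists_polyMap_eq (h : IsUnimodular N u Δ) (f : piecewisePoly N (fanOf u Δ))
    (P : Finset ι → MvPolynomial ι ℚ)
    (hP : ∀ s ∈ Δ, ∀ v : support (fanOf u Δ), (v : V) ∈ PointedCone.hull ℝ (u '' s) →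
      f.1 v = aeval (h.coord v) (P s)) :
    ∃ Q : MvPolynomial ι ℚ, h.polyMap Q = f ∧
      ∀ m : ι →₀ ℕ, Q.coeff m = if m.support ∈ Δ then (P m.support).coeff m else 0 := by
  obtain ⟨Q, hQ⟩ := exists_coeff_eq_of_support P Δ
  refine ⟨Q, Subtype.ext (funext fun v => ?_), hQ⟩
  obtain ⟨_, ⟨s, hs, rfl⟩, hv⟩ := v.2
  rw [h.polyMap_apply, hP s hs v hv, ← sub_eq_zero, ← map_sub]
  refine aeval_eq_zero_of_coeff (s := s) (fun i hi => h.coord_eq_zero hs hv hi) fun m hm => ?_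
  have hmΔ := h.subset_mem s hs _ hm
  rw [coeff_sub, hQ, if_pos hmΔ, ← coeff_sub]
  -- On the face spanned by the support of `m`, the polynomials `P m.support` and `P s` both
  -- represent `f`, so they share the coefficient of `m`.
  refine coeff_eq_zero_of_aeval (s := m.support) (fun a ha ha' => ?_) subset_rfl
  have haΔ : a ∈ coordVectors Δ := ⟨ha, _, hmΔ, ha'⟩
  let w : support (fanOf u Δ) := ⟨∑ i, a i • u i, mem_support_iff.2 ⟨a, haΔ, rfl⟩⟩
  have hw : h.coord w = a := h.coord_eq w haΔ rfl
  have h1 := hP _ hmΔ w (mem_hull_image_iff.2 ⟨a, ha, ha', rfl⟩)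
  have h2 := hP _ hs w (mem_hull_image_iff.2 ⟨a, ha, fun i hi => ha' i fun h => hi (hm h), rfl⟩)
  rw [map_sub, ← hw, ← h1, ← h2, sub_self]

theorem polyMap_surjective (h : IsUnimodular N u Δ) : Function.Surjective h.polyMap := by
  intro f
  have : ∀ s : Finset ι, ∃ P : MvPolynomial ι ℚ, s ∈ Δ → ∀ v : support (fanOf u Δ),
      (v : V) ∈ PointedCone.hull ℝ (u '' s) → f.1 v = aeval (h.coord v) P := by
    intro s
    by_cases hs : s ∈ Δ
    · obtain ⟨p, hp, hfp⟩ := f.2.2 _ ⟨s, hs, rfl⟩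
      obtain ⟨P, hP⟩ := exists_poly_of_ratPoly h.ray_mem hp
      exact ⟨P, fun _ v hv => by rw [hfp v hv, ← hP, h.sum_coord]⟩
    · exact ⟨0, fun hs' => absurd hs' hs⟩
  choose P hP using this
  obtain ⟨Q, hQ, -⟩ := h.exists_polyMap_eq f P hP
  exact ⟨Q, hQ⟩

/-- Gluing only copies coefficients, so homogeneous polynomials on the cones glue to a homogeneous
one. -/
theorem map_polyMap_homogeneousSubmodule (h : IsUnimodular N u Δ) (k : ℕ) :
    (homogeneousSubmodule ι ℚ k).map h.polyMap.toLinearMap =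
      piecewiseHomogeneous N (fanOf u Δ) k := by
  refine le_antisymm ?_ fun f hf => ?_
  · rintro _ ⟨P, hP, rfl⟩
    exact h.polyMap_mem_piecewiseHomogeneous hP
  · have : ∀ s : Finset ι, ∃ P : MvPolynomial ι ℚ, P.IsHomogeneous k ∧
        (s ∈ Δ → ∀ v : support (fanOf u Δ), (v : V) ∈ PointedCone.hull ℝ (u '' s) →
          f.1 v = aeval (h.coord v) P) := by
      intro s
      by_cases hs : s ∈ Δ
      · obtain ⟨p, hp, hfp⟩ := hf _ ⟨s, hs, rfl⟩
        obtain ⟨P, hPk, hP⟩ := exists_poly_of_ratLinear_pow h.ray_mem hp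
        exact ⟨P, hPk, fun _ v hv => by rw [hfp v hv, ← hP, h.sum_coord]⟩
      · exact ⟨0, isHomogeneous_zero _ _ _, fun hs' => absurd hs' hs⟩
    choose P hPk hP using this
    obtain ⟨Q, hQ, hQc⟩ := h.exists_polyMap_eq f P hP
    refine ⟨Q, fun m hm => ?_, hQ⟩
    rw [hQc] at hm
    exact hPk _ (ite_ne_right_iff.1 hm).2

end IsUnimodular

/-- The sum of the Stanley–Reisner ideal of `Δ` and the ideal of rational linear relations. -/
def presentationIdeal (N : AddSubgroup V) (u : ι → V) (Δ : Set (Finset ι)) :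
    Ideal (MvPolynomial ι ℚ) :=
  Ideal.span ({p | ∃ s ∉ Δ, p = ∏ i ∈ s, X i} ∪
    {p | ∃ l ∈ ratLinear N, ∃ q : ι → ℚ, (∀ i, (q i : ℝ) = l (u i)) ∧ p = ∑ i, C (q i) * X i})

/-! ### Generators and relations for the Chow ring of a fan -/

namespace IsUnimodular

variable [TopologicalSpace V] [IsTopologicalAddGroup V] [ContinuousSMul ℝ V] [T2Space V]
  [FiniteDimensional ℝ V]

theorem polyMap_linear_form (h : IsUnimodular N u Δ) {l : V → ℝ} (hl : l ∈ ratLinear N)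
    {q : ι → ℚ} (hq : ∀ i, (q i : ℝ) = l (u i)) (v : support (fanOf u Δ)) :
    (h.polyMap (∑ i, C (q i) * X i)).1 v = l v := by
  obtain ⟨q', hq', hl'⟩ := exists_linear_form h.ray_mem hl
  have : q' = q := funext fun i => Rat.cast_injective (α := ℝ) (by rw [hq, hq'])
  subst this
  rw [h.polyMap_apply, ← hl', h.sum_coord]

/-- An element `P` of the kernel has the same image as some `Q` in the presentation ideal, by
surjectivity of `polyMap`. Then `P - Q` vanishes on every cone, so its monomials have supports
outside `Δ`. -/
theorem ker_toChow_comp_polyMap (h : IsUnimodular N u Δ) :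
    RingHom.ker ((toChow N (fanOf u Δ)).comp h.polyMap) = presentationIdeal N u Δ := by
  apply le_antisymm
  · intro P hP
    have hP' : h.polyMap P ∈ linearIdeal N (fanOf u Δ) := Ideal.Quotient.eq_zero_iff_mem.1 hP
    have hle : linearIdeal N (fanOf u Δ) ≤ (presentationIdeal N u Δ).map h.polyMap := by
      refine Ideal.span_le.2 ?_
      rintro f ⟨l, hl, hfl⟩
      obtain ⟨q, hq, -⟩ := exists_linear_form h.ray_mem hl
      have : f = h.polyMap (∑ i, C (q i) * X i) :=
        Subtype.ext (funext fun v => by rw [hfl, h.polyMap_linear_form hl hq])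
      rw [this]
      exact Ideal.mem_map_of_mem _ (Ideal.subset_span (Or.inr ⟨l, hl, q, hq, rfl⟩))
    obtain ⟨Q, hQ, hQP⟩ := (Ideal.mem_map_iff_of_surjective _ h.polyMap_surjective).1 (hle hP')
    have hmem : P - Q ∈ presentationIdeal N u Δ := by
      refine mem_ideal_of_support (Δ := Δ)
        (fun s hs => Ideal.subset_span (Or.inl ⟨s, hs, rfl⟩)) fun m hm => ?_
      refine coeff_eq_zero_of_aeval (s := m.support) (fun a ha ha' => ?_) subset_rfl
      have haΔ : a ∈ coordVectors Δ := ⟨ha, _, hm, ha'⟩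
      let w : support (fanOf u Δ) := ⟨∑ i, a i • u i, mem_support_iff.2 ⟨a, haΔ, rfl⟩⟩
      rw [← h.coord_eq w haΔ rfl, ← h.polyMap_apply, map_sub, hQP, sub_self]
      rfl
    simpa using add_mem hmem hQ
  · refine Ideal.span_le.2 ?_
    rintro _ (⟨s, hs, rfl⟩ | ⟨l, hl, q, hq, rfl⟩)
    · have : h.polyMap (∏ i ∈ s, X i) = 0 := by
        refine Subtype.ext (funext fun v => ?_)
        obtain ⟨-, t, ht, ht'⟩ := h.coord_mem v
        obtain ⟨i, his, hit⟩ := Finset.not_subset.1 fun hst => hs (h.subset_mem t ht s hst)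
        rw [h.polyMap_apply, map_prod, Finset.prod_eq_zero his]
        · rfl
        · rw [aeval_X, ht' i hit]
      change toChow N (fanOf u Δ) (h.polyMap _) = 0
      rw [this, map_zero]
    · exact Ideal.Quotient.eq_zero_iff_mem.2
        (Ideal.subset_span ⟨l, hl, h.polyMap_linear_form hl hq⟩)

/-- The presentation of the Chow ring of a unimodular fan by generators and relations. -/
theorem exists_chowRing_equiv (h : IsUnimodular N u Δ) {K : Ideal (MvPolynomial ι ℚ)}
    (hK : K = presentationIdeal N u Δ) :
    ∃ φ : (MvPolynomial ι ℚ ⧸ K) ≃ₐ[ℚ] ChowRing N (fanOf u Δ),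
      (∀ k : ℕ, ((homogeneousSubmodule ι ℚ k).map (Ideal.Quotient.mkₐ ℚ K).toLinearMap).map
        φ.toLinearMap = gradedPiece N (fanOf u Δ) k) ∧
      ∀ j, ∃ δ, IsCourant N (fanOf u Δ) u j δ ∧
        φ (Ideal.Quotient.mkₐ ℚ K (X j)) = toChow N (fanOf u Δ) δ := by
  have hsurj : Function.Surjective ((toChow N (fanOf u Δ)).comp h.polyMap) :=
    (Ideal.Quotient.mkₐ_surjective ℚ _).comp h.polyMap_surjective
  let φ := (Ideal.quotientEquivAlgOfEq ℚ (hK.trans h.ker_toChow_comp_polyMap.symm)).trans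
    (Ideal.quotientKerAlgEquivOfSurjective hsurj)
  have hφ : ∀ P, φ (Ideal.Quotient.mkₐ ℚ K P) = toChow N (fanOf u Δ) (h.polyMap P) :=
    fun _ => rfl
  refine ⟨φ, fun k => ?_, fun j => ⟨h.courant j, h.isCourant_courant j, by rw [hφ, h.polyMap_X]⟩⟩
  rw [gradedPiece, ← h.map_polyMap_homogeneousSubmodule, ← Submodule.map_comp,
    ← Submodule.map_comp]
  rfl

end IsUnimodular

end FanChow

end

/-! ### Chains of sets and sums of their indicators -/

noncomputable section

open scoped Classical

theorem IsChain.exists_least_of_finite {β : Type*} {T : Set (Set β)} (hT : IsChain (· ⊆ ·) T)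
    (hfin : T.Finite) (hne : T.Nonempty) : ∃ G₀ ∈ T, ∀ G ∈ T, G₀ ⊆ G := by
  obtain ⟨G₀, h⟩ := hfin.exists_minimal hne
  refine ⟨G₀, h.1, fun G hG => ?_⟩
  rcases hT.total h.1 hG with h' | h'
  · exact h'
  · exact h.2 hG h'

theorem IsChain.exists_greatest_of_finite {β : Type*} {T : Set (Set β)}
    (hT : IsChain (· ⊆ ·) T) (hfin : T.Finite) (hne : T.Nonempty) :
    ∃ G₀ ∈ T, ∀ G ∈ T, G ⊆ G₀ := by
  obtain ⟨G₀, h⟩ := hfin.exists_maximal hne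
  refine ⟨G₀, h.1, fun G hG => ?_⟩
  rcases hT.total hG h.1 with h' | h'
  · exact h'
  · exact h.2 hG h'

/-- Above a proper member `F` of a finite chain of subsets of `E`, there is a point that separates
`F` from all larger members. -/
theorem IsChain.exists_notMem_forall_ssubset {β : Type*} {T : Set (Set β)}
    (hT : IsChain (· ⊆ ·) T) (hfin : T.Finite) {E F : Set β} (hE : ∀ G ∈ T, G ⊆ E)
    (hF : F ⊂ E) : ∃ q ∈ E, q ∉ F ∧ ∀ G ∈ T, F ⊂ G → q ∈ G := by
  by_cases hne : {G ∈ T | F ⊂ G}.Nonempty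
  · obtain ⟨G₀, hG₀, hle⟩ := (hT.mono (Set.sep_subset _ _)).exists_least_of_finite
      (hfin.subset (Set.sep_subset _ _)) hne
    obtain ⟨q, hq, hqF⟩ := Set.exists_of_ssubset hG₀.2
    exact ⟨q, hE _ hG₀.1 hq, hqF, fun G hG hFG => hle G ⟨hG, hFG⟩ hq⟩
  · obtain ⟨q, hq, hqF⟩ := Set.exists_of_ssubset hF
    exact ⟨q, hq, hqF, fun G hG hFG => absurd ⟨G, hG, hFG⟩ hne⟩

theorem isChain_image_val {α ι : Type*} {S : ι → Set α} {s : Set ι}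
    (hs : ∀ F ∈ s, ∀ G ∈ s, S F ⊆ S G ∨ S G ⊆ S F) : IsChain (· ⊆ ·) (S '' s) := by
  rintro _ ⟨F, hF, rfl⟩ _ ⟨G, hG, rfl⟩ _
  exact hs F hF G hG

section ChainSums

variable {α κ : Type*} [Fintype κ] (S : κ → Set α)

/-- A member of the chain containing `q` is not inside `S F`, so it contains `S F` and hence `p`;
the term of `F` makes the inequality strict. -/
theorem sum_indicator_lt_of_chain {a : κ → ℝ} (ha : ∀ G, 0 ≤ a G)
    (hc : ∀ G G', a G ≠ 0 → a G' ≠ 0 → S G ⊆ S G' ∨ S G' ⊆ S G) {F : κ} (hF : a F ≠ 0)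
    {p q : α} (hp : p ∈ S F) (hq : q ∉ S F) :
    ∑ G, a G * (if q ∈ S G then 1 else 0) < ∑ G, a G * (if p ∈ S G then 1 else 0) := by
  refine Finset.sum_lt_sum (fun G _ => ?_) ⟨F, Finset.mem_univ _, ?_⟩
  · by_cases hG : a G = 0
    · simp [hG]
    by_cases hqG : q ∈ S G
    · have hpG : p ∈ S G := by
        rcases hc F G hF hG with h | h
        · exact h hp
        · exact absurd (h hqG) hq
      simp [hqG, hpG]
    · simp only [hqG, if_false, mul_zero]
      exact mul_nonneg (ha G) (by split_ifs <;> norm_num)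
  · simpa [hp, hq] using lt_of_le_of_ne (ha F) (Ne.symm hF)

/-- If two nonnegative combinations of chains of indicator functions agree up to a constant, then
the two chains are comparable. -/
theorem subset_or_subset_of_sum_indicator_eq {a b : κ → ℝ} {E : Set α} (hE : ∀ G, S G ⊆ E)
    (ha : ∀ G, 0 ≤ a G) (hb : ∀ G, 0 ≤ b G)
    (hac : ∀ G G', a G ≠ 0 → a G' ≠ 0 → S G ⊆ S G' ∨ S G' ⊆ S G)
    (hbc : ∀ G G', b G ≠ 0 → b G' ≠ 0 → S G ⊆ S G' ∨ S G' ⊆ S G)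
    (hab : ∀ p ∈ E, ∀ q ∈ E,
      ∑ G, a G * (if p ∈ S G then 1 else 0) - ∑ G, a G * (if q ∈ S G then 1 else 0) =
      ∑ G, b G * (if p ∈ S G then 1 else 0) - ∑ G, b G * (if q ∈ S G then 1 else 0))
    {F G : κ} (hF : a F ≠ 0) (hG : b G ≠ 0) : S F ⊆ S G ∨ S G ⊆ S F := by
  by_contra! h
  obtain ⟨p, hpF, hpG⟩ := Set.not_subset.1 h.1
  obtain ⟨q, hqG, hqF⟩ := Set.not_subset.1 h.2
  -- The first combination is larger at `p` than at `q`, the second larger at `q` than at `p`, yet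
  -- their differences agree.
  have h1 := sum_indicator_lt_of_chain S ha hac hF hpF hqF
  have h2 := sum_indicator_lt_of_chain S hb hbc hG hqG hpG
  have h3 := hab p (hE F hpF) q (hE G hqG)
  linarith

end ChainSums

/-! ### Flags of flats, rays and rational functionals -/

namespace MatroidChow

variable {α : Type*} (M : Matroid α)

theorem ProperFlat.ssubset_ground (F : ProperFlat M) : F.1 ⊂ M.E :=
  F.2.1.subset_ground.ssubset_of_ne F.2.2

theorem NonemptyProperFlat.ssubset_ground (F : NonemptyProperFlat M) : F.1 ⊂ M.E :=
  F.2.1.subset_ground.ssubset_of_ne F.2.2.1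

theorem e_mem_lattice (S : Set α) : e M S ∈ lattice M := by
  intro i _
  by_cases hi : (i : α) ∈ S
  · exact ⟨1, by simp [e, hi]⟩
  · exact ⟨0, by simp [e, hi]⟩

theorem exists_rat_of_mem_lattice {w : M.E → ℝ} (hw : w ∈ lattice M) (i : M.E) :
    ∃ q : ℚ, w i = (q : ℝ) := by
  obtain ⟨n, hn⟩ := hw i trivial
  exact ⟨n, by simpa using hn.symm⟩

/-- The simplicial complex of flags of nonempty proper flats. -/
def flagComplex : Set (Finset (NonemptyProperFlat M)) :=
  {s | IsChain (· ≤ ·) (s : Set (NonemptyProperFlat M))}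

theorem mem_flagComplex_iff {s : Finset (NonemptyProperFlat M)} :
    s ∈ flagComplex M ↔ ∀ F ∈ s, ∀ G ∈ s, F.1 ⊆ G.1 ∨ G.1 ⊆ F.1 :=
  ⟨fun h _ hF _ hG => h.total hF hG, fun h F hF G hG _ => h F hF G hG⟩

theorem ray_mem (F : NonemptyProperFlat M) : ray M F ∈ quotLattice M :=
  ⟨_, e_mem_lattice M F.1, rfl⟩

theorem augRay_inl_apply (i k : M.E) : augRay M (Sum.inl i) k = if k = i then 1 else 0 := by
  simp [augRay, e, Subtype.ext_iff]

theorem augRay_inr_apply (F : ProperFlat M) (k : M.E) :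
    augRay M (Sum.inr F) k = -(if (k : α) ∈ F.1 then 0 else 1) := by
  by_cases hk : (k : α) ∈ F.1 <;> simp [augRay, e, hk]

theorem augRay_mem (j : M.E ⊕ ProperFlat M) : augRay M j ∈ lattice M := by
  rcases j with i | F
  · exact e_mem_lattice M _
  · exact neg_mem (e_mem_lattice M _)

theorem proj_rat (k : M.E) : ∀ v ∈ lattice M,
    ∃ q : ℚ, (LinearMap.proj k : (M.E → ℝ) →ₗ[ℝ] ℝ) v = (q : ℝ) :=
  fun _ hv => exists_rat_of_mem_lattice M hv k

/-- The difference of two coordinates, as a functional on `ℝ^E / ⟨e_E⟩`. -/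
def coordDiff (p q : M.E) : QuotSpace M →ₗ[ℝ] ℝ :=
  Submodule.liftQ (Submodule.span ℝ {e M M.E})
    (LinearMap.proj (R := ℝ) (φ := fun _ : M.E => ℝ) p - LinearMap.proj q) (by
      rw [Submodule.span_singleton_le_iff_mem, LinearMap.mem_ker, LinearMap.sub_apply]
      simp [e])

theorem coordDiff_rat (p q : M.E) : ∀ v ∈ quotLattice M, ∃ r : ℚ, coordDiff M p q v = (r : ℝ) := by
  rintro _ ⟨w, hw, rfl⟩
  obtain ⟨r, hr⟩ := exists_rat_of_mem_lattice M hw p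
  obtain ⟨t, ht⟩ := exists_rat_of_mem_lattice M hw q
  refine ⟨r - t, ?_⟩
  push_cast
  rw [← hr, ← ht]
  rfl

theorem coordDiff_ray (p q : M.E) (F : NonemptyProperFlat M) :
    coordDiff M p q (ray M F) =
      (if (p : α) ∈ F.1 then 1 else 0) - (if (q : α) ∈ F.1 then 1 else 0) := rfl

variable [M.Finite]

/-- The ground set of a finite matroid is a finite type. -/
@[reducible] def fintypeGround : Fintype M.E := M.ground_finite.fintype

attribute [local instance] fintypeGround

theorem e_eq_sum (S : Set α) :
    e M S = ∑ i : M.E, (if (i : α) ∈ S then (1 : ℝ) else 0) • e M {(i : α)} := by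
  funext j
  rw [Finset.sum_apply, Finset.sum_eq_single j]
  · simp [e]
  · intro i _ hij
    have : (j : α) ≠ i := fun h => hij (Subtype.ext h.symm)
    simp [e, this]
  · simp

/-! ### The Bergman fan -/

theorem bergmanFan_eq : bergmanFan M = FanChow.fanOf (ray M) (flagComplex M) := by
  ext σ
  constructor
  · rintro ⟨𝓕, h𝓕, rfl⟩
    exact ⟨𝓕.toFinset, by simpa [flagComplex] using h𝓕, by simp⟩
  · rintro ⟨s, hs, rfl⟩
    exact ⟨s, hs, rfl⟩

/-- The functional dual to `F` in a flag is `x_p - x_q`, with `p` in `F` but in no smaller member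
and `q` outside `F` but in every larger one: smaller members contain neither point, larger ones
both. -/
theorem isUnimodular_bergmanFan :
    FanChow.IsUnimodular (quotLattice M) (ray M) (flagComplex M) where
  subset_mem s hs t hts := hs.mono hts
  singleton_mem F := by simp [flagComplex]
  ray_mem := ray_mem M
  exists_dual s hs F hF := by
    rw [mem_flagComplex_iff] at hs
    have hT := isChain_image_val (S := fun F : NonemptyProperFlat M => F.1) (s := s) hs
    have hfin : ((fun F : NonemptyProperFlat M => F.1) '' s).Finite := s.finite_toSet.image _
    obtain ⟨q, hqE, hqF, hq⟩ := hT.exists_notMem_forall_ssubset hfin (E := M.E)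
      (by rintro _ ⟨G, -, rfl⟩; exact G.2.1.subset_ground) (F.ssubset_ground M)
    have : ∃ p ∈ F.1, ∀ G ∈ s, G.1 ⊂ F.1 → p ∉ G.1 := by
      by_cases hne : {H ∈ (fun F : NonemptyProperFlat M => F.1) '' s | H ⊂ F.1}.Nonempty
      · obtain ⟨G₀, hG₀, hle⟩ := (hT.mono (Set.sep_subset _ _)).exists_greatest_of_finite
          (hfin.subset (Set.sep_subset _ _)) hne
        obtain ⟨p, hp, hpG⟩ := Set.exists_of_ssubset hG₀.2
        exact ⟨p, hp, fun G hG hGF hpG' => hpG (hle _ ⟨⟨G, hG, rfl⟩, hGF⟩ hpG')⟩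
      -- With no smaller member any point of `F` serves; this is where `F` must be nonempty.
      · obtain ⟨p, hp⟩ := F.2.2.2
        exact ⟨p, hp, fun G hG hGF => absurd ⟨G.1, ⟨G, hG, rfl⟩, hGF⟩ hne⟩
    obtain ⟨p, hpF, hp⟩ := this
    refine ⟨coordDiff M ⟨p, F.2.1.subset_ground hpF⟩ ⟨q, hqE⟩, coordDiff_rat M _ _,
      fun G hG => ?_⟩
    rw [coordDiff_ray]
    by_cases hGF : G = F
    · subst hGF
      simp [hpF, hqF]
    have hne : G.1 ≠ F.1 := fun h => hGF (Subtype.ext h)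
    rcases hs G hG F hF with h | h
    · have hqG : q ∉ G.1 := fun hqG => hqF (h hqG)
      simp [hGF, hp G hG (h.ssubset_of_ne hne), hqG]
    · simp [hGF, h hpF, hq G.1 ⟨G, hG, rfl⟩ (h.ssubset_of_ne hne.symm)]
  exists_common := by
    rintro a ⟨ha, s, hs, has⟩ b ⟨hb, t, ht, hbt⟩ hab
    rw [mem_flagComplex_iff] at hs ht
    have hac : ∀ G G', a G ≠ 0 → a G' ≠ 0 → G.1 ⊆ G'.1 ∨ G'.1 ⊆ G.1 := fun G G' hG hG' =>
      hs G (not_not.1 (mt (has G) hG)) G' (not_not.1 (mt (has G') hG'))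
    have hbc : ∀ G G', b G ≠ 0 → b G' ≠ 0 → G.1 ⊆ G'.1 ∨ G'.1 ⊆ G.1 := fun G G' hG hG' =>
      ht G (not_not.1 (mt (hbt G) hG)) G' (not_not.1 (mt (hbt G') hG'))
    have key : ∀ F G, a F ≠ 0 → b G ≠ 0 → F.1 ⊆ G.1 ∨ G.1 ⊆ F.1 := by
      intro F G hF hG
      refine subset_or_subset_of_sum_indicator_eq (fun F : NonemptyProperFlat M => F.1)
        (fun F => F.2.1.subset_ground) ha hb hac hbc (fun p hp q hq => ?_) hF hG
      have := congrArg (coordDiff M ⟨p, hp⟩ ⟨q, hq⟩) hab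
      simpa only [map_sum, map_smul, coordDiff_ray, smul_eq_mul, mul_sub,
        Finset.sum_sub_distrib] using this
    refine ⟨Finset.univ.filter fun F => a F ≠ 0 ∨ b F ≠ 0, ?_, fun F hF => by simpa using hF⟩
    rw [mem_flagComplex_iff]
    intro F hF G hG
    rw [Finset.mem_filter] at hF hG
    rcases hF.2 with hF | hF <;> rcases hG.2 with hG | hG
    · exact hac F G hF hG
    · exact key F G hF hG
    · exact (key G F hG hF).symm
    · exact hbc F G hF hG

section

open MvPolynomial

theorem chowI_sup_chowJ :
    chowI M ⊔ chowJ M =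
      FanChow.presentationIdeal (quotLattice M) (ray M) (flagComplex M) := by
  apply le_antisymm
  · refine sup_le (Ideal.span_le.2 ?_) (Ideal.span_le.2 ?_)
    · rintro _ ⟨i, hi, j, hj, -, rfl⟩
      refine Ideal.subset_span (Or.inr ⟨_, ⟨coordDiff M ⟨i, hi⟩ ⟨j, hj⟩, coordDiff_rat M _ _, rfl⟩,
        fun F => (if i ∈ F.1 then 1 else 0) - (if j ∈ F.1 then 1 else 0), fun F => ?_, ?_⟩)
      · by_cases hi' : i ∈ F.1 <;> by_cases hj' : j ∈ F.1 <;> simp [coordDiff_ray, hi', hj']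
      · simp only [Finset.sum_filter, ← Finset.sum_sub_distrib]
        refine Finset.sum_congr rfl fun F _ => ?_
        split_ifs <;> simp
    · rintro _ ⟨F, G, hFG, hGF, rfl⟩
      refine Ideal.subset_span (Or.inl ⟨{F, G}, fun h => ?_, ?_⟩)
      · rw [mem_flagComplex_iff] at h
        exact (h F (by simp) G (by simp)).elim hFG hGF
      · rw [Finset.prod_pair]
        rintro rfl
        exact hFG subset_rfl
  · refine Ideal.span_le.2 ?_
    rintro _ (⟨s, hs, rfl⟩ | ⟨_, ⟨l, hl, rfl⟩, q, hq, rfl⟩)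
    · refine Ideal.mem_sup_right ?_
      rw [mem_flagComplex_iff] at hs
      push Not at hs
      obtain ⟨F, hF, G, hG, hFG, hGF⟩ := hs
      have hne : F ≠ G := by
        rintro rfl
        exact hFG subset_rfl
      refine Ideal.mem_of_dvd _ ?_ (Ideal.subset_span ⟨F, G, hFG, hGF, rfl⟩)
      rw [← Finset.prod_pair hne]
      exact Finset.prod_dvd_prod_of_subset _ _ _ (by
        intro x hx
        rcases Finset.mem_insert.1 hx with rfl | hx
        · exact hF
        · rw [Finset.mem_singleton.1 hx]
          exact hG)
    · refine Ideal.mem_sup_left ?_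
      choose c hc using fun i : M.E =>
        hl (Submodule.Quotient.mk (e M {(i : α)})) ⟨_, e_mem_lattice M _, rfl⟩
      have hlS : ∀ S : Set α, l (Submodule.Quotient.mk (e M S)) =
          ((∑ i : M.E, c i * (if (i : α) ∈ S then 1 else 0) : ℚ) : ℝ) := by
        intro S
        change (l ∘ₗ Submodule.mkQ _) (e M S) = _
        have hc' : ∀ i : M.E, (l ∘ₗ Submodule.mkQ _) (e M {(i : α)}) = c i := hc
        conv_lhs => rw [e_eq_sum M S]
        rw [map_sum, Rat.cast_sum]
        refine Finset.sum_congr rfl fun i _ => ?_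
        rw [map_smul, hc', smul_eq_mul, mul_comm]
        split_ifs <;> simp
      have hq' : ∀ F : NonemptyProperFlat M,
          q F = ∑ i : M.E, c i * (if (i : α) ∈ F.1 then 1 else 0) := fun F =>
        Rat.cast_injective (α := ℝ) (by rw [hq, ← hlS]; rfl)
      -- The functional descends to the quotient, so it vanishes on `e_E`.
      have hc0 : ∑ i : M.E, c i = 0 := by
        have h0 : (Submodule.Quotient.mk (e M M.E) : QuotSpace M) = 0 :=
          (Submodule.Quotient.mk_eq_zero _).2 (Submodule.mem_span_singleton_self _)
        have := hlS M.E
        rw [h0, map_zero] at this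
        have := (Rat.cast_eq_zero.1 this.symm)
        simpa using this
      have hp : ∑ F, C (q F) * X F =
          ∑ i : M.E, C (c i) * ∑ F : NonemptyProperFlat M with (i : α) ∈ F.1, X F := by
        simp only [hq', Finset.mul_sum, map_sum, Finset.sum_mul, Finset.sum_filter]
        rw [Finset.sum_comm]
        refine Finset.sum_congr rfl fun i _ => Finset.sum_congr rfl fun F _ => ?_
        split_ifs <;> simp
      rw [hp]
      rcases isEmpty_or_nonempty M.E with hE | ⟨⟨i₀⟩⟩
      · simp
      -- Since the `c i` sum to zero, subtracting the sum at a base point `i₀` from every term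
      -- changes nothing and exhibits generators of `chowI`.
      have : ∑ i : M.E, C (c i) * ∑ F : NonemptyProperFlat M with (i : α) ∈ F.1, X F =
          ∑ i : M.E, C (c i) * (∑ F : NonemptyProperFlat M with (i : α) ∈ F.1, X F -
            ∑ F : NonemptyProperFlat M with (i₀ : α) ∈ F.1, X F) := by
        simp only [mul_sub, Finset.sum_sub_distrib, ← Finset.sum_mul, ← map_sum, hc0, map_zero,
          zero_mul, sub_zero]
      rw [this]
      refine sum_mem fun i _ => Ideal.mul_mem_left _ _ ?_
      by_cases hi : (i : α) = i₀
      · simp [hi]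
      · exact Ideal.subset_span ⟨i, i.2, i₀, i₀.2, hi, rfl⟩

end

/-! ### The augmented Bergman fan -/

/-- The simplicial complex of the augmented Bergman fan. -/
def augComplex : Set (Finset (M.E ⊕ ProperFlat M)) :=
  {s | M.Indep {i | ∃ j : M.E, Sum.inl j ∈ s ∧ (j : α) = i} ∧
    (∀ F G, Sum.inr F ∈ s → Sum.inr G ∈ s → F.1 ⊆ G.1 ∨ G.1 ⊆ F.1) ∧
    ∀ (i : M.E) (F : ProperFlat M), Sum.inl i ∈ s → Sum.inr F ∈ s → (i : α) ∈ F.1}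

theorem augCone_eq (I : Set α) (𝓕 : Set (ProperFlat M)) :
    augCone M I 𝓕 = PointedCone.hull ℝ (augRay M ''
      ((Finset.univ.filter fun j => Sum.elim (fun i : M.E => (i : α) ∈ I) (· ∈ 𝓕) j :
        Finset (M.E ⊕ ProperFlat M)) : Set (M.E ⊕ ProperFlat M))) := by
  rw [augCone]
  congr 1
  ext v
  constructor
  · rintro (⟨i, hi, rfl⟩ | ⟨F, hF, rfl⟩)
    · exact ⟨Sum.inl i, by simpa using hi, rfl⟩
    · exact ⟨Sum.inr F, by simpa using hF, rfl⟩
  · rintro ⟨i | F, h, rfl⟩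
    · exact Or.inl ⟨i, by simpa using h, rfl⟩
    · exact Or.inr ⟨F, by simpa using h, rfl⟩

theorem augBergmanFan_eq : augBergmanFan M = FanChow.fanOf (augRay M) (augComplex M) := by
  ext σ
  constructor
  · rintro ⟨I, 𝓕, hI, h𝓕, hI𝓕, rfl⟩
    refine ⟨_, ⟨hI.subset ?_, ?_, ?_⟩, augCone_eq M I 𝓕⟩
    · rintro _ ⟨j, hj, rfl⟩
      simpa using hj
    · intro F G hF hG
      exact h𝓕.total (by simpa using hF) (by simpa using hG)
    · intro i F hi hF
      exact hI𝓕 F (by simpa using hF) (by simpa using hi)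
  · rintro ⟨s, ⟨hI, hs, hIs⟩, rfl⟩
    refine ⟨_, {F | Sum.inr F ∈ s}, hI, fun F hF G hG _ => hs F G hF hG, ?_, ?_⟩
    · rintro F hF _ ⟨i, hi, rfl⟩
      exact hIs i F hi hF
    · rw [augCone_eq]
      congr 2
      ext (i | F) <;> simp

theorem sum_augRay_apply (a : M.E ⊕ ProperFlat M → ℝ) (k : M.E) :
    (∑ j, a j • augRay M j) k =
      a (Sum.inl k) - ∑ F, a (Sum.inr F) * (if (k : α) ∈ F.1 then 0 else 1) := by
  rw [Finset.sum_apply, Fintype.sum_sum_type]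
  simp [augRay_inl_apply, augRay_inr_apply, sub_eq_add_neg]

/-- A combination of rays of one cone determines its positive part and its negative part. -/
theorem eq_of_sum_augRay_eq {a b : M.E ⊕ ProperFlat M → ℝ}
    (ha : a ∈ FanChow.coordVectors (augComplex M)) (hb : b ∈ FanChow.coordVectors (augComplex M))
    (hab : ∑ j, a j • augRay M j = ∑ j, b j • augRay M j) (k : M.E) :
    a (Sum.inl k) = b (Sum.inl k) ∧
      ∑ F, a (Sum.inr F) * (if (k : α) ∈ F.1 then (0 : ℝ) else 1) =
        ∑ F, b (Sum.inr F) * (if (k : α) ∈ F.1 then 0 else 1) := by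
  -- If `e_k` occurs in a cone, every flat of its flag contains `k`, so positive and negative
  -- contributions never meet in one coordinate.
  have key : ∀ c ∈ FanChow.coordVectors (augComplex M), 0 ≤ c (Sum.inl k) ∧
      0 ≤ ∑ F, c (Sum.inr F) * (if (k : α) ∈ F.1 then (0 : ℝ) else 1) ∧
      (c (Sum.inl k) = 0 ∨
        ∑ F, c (Sum.inr F) * (if (k : α) ∈ F.1 then (0 : ℝ) else 1) = 0) := by
    rintro c ⟨hc, s, ⟨-, -, hs⟩, hcs⟩
    refine ⟨hc _, Finset.sum_nonneg fun F _ => mul_nonneg (hc _) (by split_ifs <;> norm_num), ?_⟩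
    by_cases hk : c (Sum.inl k) = 0
    · exact Or.inl hk
    refine Or.inr (Finset.sum_eq_zero fun F _ => ?_)
    by_cases hF : c (Sum.inr F) = 0
    · simp [hF]
    · simp [hs k F (not_not.1 (mt (hcs _) hk)) (not_not.1 (mt (hcs _) hF))]
  have h := congrFun hab k
  rw [sum_augRay_apply, sum_augRay_apply] at h
  obtain ⟨a1, a2, a3⟩ := key a ha
  obtain ⟨b1, b2, b3⟩ := key b hb
  rcases a3 with a3 | a3 <;> rcases b3 with b3 | b3 <;> constructor <;> linarith

/-- The coordinate at `i` is dual to `e_i`, as it vanishes on the rays of flats containing `i`. For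
a flat `F` of the flag, `x_p - x_q` works as in the Bergman fan when a smaller member exists: `I`
lies in that member, so it avoids both `p` and `q`. For the least member `-x_q` alone suffices. -/
theorem isUnimodular_augBergmanFan [M.Loopless] :
    FanChow.IsUnimodular (lattice M) (augRay M) (augComplex M) where
  subset_mem s hs t hts := by
    obtain ⟨hI, hs, hIs⟩ := hs
    refine ⟨hI.subset ?_, fun F G hF hG => hs F G (hts hF) (hts hG),
      fun i F hi hF => hIs i F (hts hi) (hts hF)⟩
    rintro _ ⟨j, hj, rfl⟩
    exact ⟨j, hts hj, rfl⟩
  singleton_mem j := by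
    rcases j with i | F
    -- Without loops each `{i}` is independent, so `e_i` spans a ray of the fan.
    · refine ⟨(M.indep_singleton.2 (M.isNonloop_of_loopless i.2)).subset ?_, by simp, by simp⟩
      rintro _ ⟨j, hj, rfl⟩
      simp_all
    · refine ⟨M.empty_indep.subset ?_, ?_, by simp⟩
      · rintro _ ⟨j, hj, rfl⟩
        simp at hj
      · intro F' G' hF' hG'
        simp_all
  ray_mem := augRay_mem M
  exists_dual s hs j hj := by
    obtain ⟨-, hs, hIs⟩ := hs
    rcases j with i | F
    · refine ⟨LinearMap.proj i, proj_rat M i, ?_⟩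
      rintro (k | G) hG
      · rw [LinearMap.proj_apply, augRay_inl_apply]
        simp [eq_comm]
      · rw [LinearMap.proj_apply, augRay_inr_apply]
        simp [hIs i G hj hG]
    have hs' : ∀ G ∈ {G | Sum.inr G ∈ s}, ∀ H ∈ {G | Sum.inr G ∈ s}, G.1 ⊆ H.1 ∨ H.1 ⊆ G.1 :=
      fun G hG H hH => hs G H hG hH
    have hT := isChain_image_val (S := fun F : ProperFlat M => F.1) hs'
    have hfin : ((fun F : ProperFlat M => F.1) '' {G | Sum.inr G ∈ s}).Finite := Set.toFinite _
    obtain ⟨q, hqE, hqF, hq⟩ := hT.exists_notMem_forall_ssubset hfin (E := M.E)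
      (by rintro _ ⟨G, -, rfl⟩; exact G.2.1.subset_ground) (F.ssubset_ground M)
    have hqI : ∀ k : M.E, Sum.inl k ∈ s → (⟨q, hqE⟩ : M.E) ≠ k := by
      rintro k hk rfl
      exact hqF (hIs _ F hk hj)
    have hqG : ∀ G, Sum.inr G ∈ s → (q ∈ G.1 ↔ ¬ G.1 ⊆ F.1) := by
      refine fun G hG => ⟨fun h h' => hqF (h' h), fun h => ?_⟩
      exact hq G.1 ⟨G, hG, rfl⟩ (((hs F G hj hG).resolve_right h).ssubset_of_not_subset h)
    by_cases hne : {H ∈ (fun F : ProperFlat M => F.1) '' {G | Sum.inr G ∈ s} | H ⊂ F.1}.Nonempty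
    · obtain ⟨_, ⟨⟨G₀, hG₀s, rfl⟩, hG₀F⟩, hle⟩ :=
        (hT.mono (Set.sep_subset _ _)).exists_greatest_of_finite
          (hfin.subset (Set.sep_subset _ _)) hne
      obtain ⟨p, hpF, hpG⟩ := Set.exists_of_ssubset hG₀F
      have hpE : p ∈ M.E := F.2.1.subset_ground hpF
      have hpI : ∀ k : M.E, Sum.inl k ∈ s → (⟨p, hpE⟩ : M.E) ≠ k := by
        rintro k hk rfl
        exact hpG (hIs _ G₀ hk hG₀s)
      refine ⟨LinearMap.proj ⟨p, hpE⟩ - LinearMap.proj ⟨q, hqE⟩, fun v hv => ?_, ?_⟩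
      · obtain ⟨r, hr⟩ := exists_rat_of_mem_lattice M hv ⟨p, hpE⟩
        obtain ⟨t, ht⟩ := exists_rat_of_mem_lattice M hv ⟨q, hqE⟩
        exact ⟨r - t, by simp [hr, ht]⟩
      rintro (k | G) hG
      · simp [augRay_inl_apply, hpI k hG, hqI k hG]
      · simp only [LinearMap.sub_apply, LinearMap.proj_apply, augRay_inr_apply, hqG G hG]
        by_cases hGF : G = F
        · subst hGF
          simp [hpF]
        have hne : G.1 ≠ F.1 := fun h => hGF (Subtype.ext h)
        by_cases h : G.1 ⊆ F.1
        · have hpG' : p ∉ G.1 := fun hp => hpG (hle _ ⟨⟨G, hG, rfl⟩, h.ssubset_of_ne hne⟩ hp)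
          simp [hGF, h, hpG']
        · simp [hGF, h, (hs F G hj hG).resolve_right h hpF]
    · refine ⟨-LinearMap.proj ⟨q, hqE⟩, fun v hv => ?_, ?_⟩
      · obtain ⟨t, ht⟩ := exists_rat_of_mem_lattice M hv ⟨q, hqE⟩
        exact ⟨-t, by simp [ht]⟩
      rintro (k | G) hG
      · simp [augRay_inl_apply, hqI k hG]
      · simp only [LinearMap.neg_apply, LinearMap.proj_apply, augRay_inr_apply, hqG G hG]
        by_cases hGF : G = F
        · simp [hGF]
        have : ¬ G.1 ⊆ F.1 := fun h => hne
          ⟨G.1, ⟨G, hG, rfl⟩, h.ssubset_of_ne fun h => hGF (Subtype.ext h)⟩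
        simp [hGF, this]
  exists_common a ha b hb hab := by
    have heq := eq_of_sum_augRay_eq M ha hb hab
    obtain ⟨ha, s, ⟨hI, hs, hIs⟩, has⟩ := ha
    obtain ⟨hb, t, ⟨-, ht, hIt⟩, hbt⟩ := hb
    have has' : ∀ j, a j ≠ 0 → j ∈ s := fun j hj => not_not.1 (mt (has j) hj)
    have hbt' : ∀ j, b j ≠ 0 → j ∈ t := fun j hj => not_not.1 (mt (hbt j) hj)
    have key : ∀ F G, a (Sum.inr F) ≠ 0 → b (Sum.inr G) ≠ 0 → F.1 ⊆ G.1 ∨ G.1 ⊆ F.1 := by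
      intro F G hF hG
      refine subset_or_subset_of_sum_indicator_eq (fun F : ProperFlat M => F.1)
        (a := fun F => a (Sum.inr F)) (b := fun F => b (Sum.inr F))
        (fun F => F.2.1.subset_ground) (fun _ => ha _) (fun _ => hb _)
        (fun F G hF hG => hs F G (has' _ hF) (has' _ hG))
        (fun F G hF hG => ht F G (hbt' _ hF) (hbt' _ hG)) (fun p hp q hq => ?_) hF hG
      -- Passing from complements to flats costs the total weight, which cancels in differences
      -- between two points.
      have hcompl : ∀ (c : M.E ⊕ ProperFlat M → ℝ) (p : α),
          ∑ F : ProperFlat M, c (Sum.inr F) * (if p ∈ F.1 then (1 : ℝ) else 0) =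
            ∑ F : ProperFlat M, c (Sum.inr F) -
              ∑ F : ProperFlat M, c (Sum.inr F) * (if p ∈ F.1 then (0 : ℝ) else 1) := by
        intro c p
        rw [← Finset.sum_sub_distrib]
        refine Finset.sum_congr rfl fun F _ => ?_
        split_ifs <;> simp
      have h1 := (heq ⟨p, hp⟩).2
      have h2 := (heq ⟨q, hq⟩).2
      simp only [hcompl]
      linarith
    refine ⟨Finset.univ.filter fun j => a j ≠ 0 ∨ b j ≠ 0, ⟨hI.subset ?_, ?_, ?_⟩,
      fun F hF => by simpa using hF⟩
    · rintro _ ⟨j, hj, rfl⟩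
      refine ⟨j, has' _ ?_, rfl⟩
      simpa [← (heq j).1] using hj
    · intro F G hF hG
      rw [Finset.mem_filter] at hF hG
      rcases hF.2 with hF | hF <;> rcases hG.2 with hG | hG
      · exact hs F G (has' _ hF) (has' _ hG)
      · exact key F G hF hG
      · exact (key G F hG hF).symm
      · exact ht F G (hbt' _ hF) (hbt' _ hG)
    · intro i F hi hF
      -- The coefficients of `e_i` agree in `a` and `b`, so `i` belongs to both cones and lies in
      -- the flats of either flag.
      have hai : a (Sum.inl i) ≠ 0 := by simpa [← (heq i).1] using hi
      have hbi : b (Sum.inl i) ≠ 0 := by rwa [← (heq i).1]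
      rcases (Finset.mem_filter.1 hF).2 with hF | hF
      · exact hIs i F (has' _ hai) (has' _ hF)
      · exact hIt i F (hbt' _ hbi) (hbt' _ hF)

section

open MvPolynomial

/-- Incomparable flats, or a flat missing an `i`, give a generator of `augChowJ` dividing the
product. A dependent set needs the linear relation of an element in the closure of the others. -/
theorem prod_mem_augChow_of_notMem {s : Finset (M.E ⊕ ProperFlat M)} (hs : s ∉ augComplex M) :
    ∏ j ∈ s, (X j : MvPolynomial (M.E ⊕ ProperFlat M) ℚ) ∈ augChowI M ⊔ augChowJ M := by
  have hpair : ∀ {t : Finset (M.E ⊕ ProperFlat M)} {j k}, j ≠ k → j ∈ t → k ∈ t →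
      (X j * X k : MvPolynomial (M.E ⊕ ProperFlat M) ℚ) ∈ augChowJ M →
      ∏ j ∈ t, (X j : MvPolynomial (M.E ⊕ ProperFlat M) ℚ) ∈ augChowI M ⊔ augChowJ M := by
    intro t j k hjk hj hk h
    refine Ideal.mem_of_dvd _ ?_ (Ideal.mem_sup_right h)
    rw [← Finset.prod_pair hjk]
    refine Finset.prod_dvd_prod_of_subset _ _ _ fun x hx => ?_
    rcases Finset.mem_insert.1 hx with rfl | hx
    · exact hj
    · rw [Finset.mem_singleton.1 hx]
      exact hk
  by_cases hI : M.Indep {i | ∃ j : M.E, Sum.inl j ∈ s ∧ (j : α) = i}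
  · by_cases hc : ∀ F G, Sum.inr F ∈ s → Sum.inr G ∈ s → F.1 ⊆ G.1 ∨ G.1 ⊆ F.1
    · have : ¬ ∀ (i : M.E) (F : ProperFlat M), Sum.inl i ∈ s → Sum.inr F ∈ s → (i : α) ∈ F.1 :=
        fun h => hs ⟨hI, hc, h⟩
      push Not at this
      obtain ⟨i, F, hi, hF, hiF⟩ := this
      exact hpair (by simp) hi hF (Ideal.subset_span (Or.inr ⟨i, F, hiF, rfl⟩))
    · push Not at hc
      obtain ⟨F, G, hF, hG, hFG, hGF⟩ := hc
      refine hpair ?_ hF hG (Ideal.subset_span (Or.inl ⟨F, G, hFG, hGF, rfl⟩))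
      rintro h
      rw [Sum.inr.inj h] at hFG
      exact hFG subset_rfl
  · rw [Matroid.indep_iff_forall_notMem_closure_sdiff
      (by rintro _ ⟨j, -, rfl⟩; exact j.2)] at hI
    push Not at hI
    obtain ⟨_, ⟨i, hi, rfl⟩, hcl⟩ := hI
    rw [← Finset.mul_prod_erase _ _ hi]
    have hlin : (X (Sum.inl i) - ∑ F : ProperFlat M with (i : α) ∉ F.1, X (Sum.inr F) :
        MvPolynomial (M.E ⊕ ProperFlat M) ℚ) ∈ augChowI M ⊔ augChowJ M :=
      Ideal.mem_sup_left (Ideal.subset_span ⟨i, rfl⟩)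
    rw [← sub_add_cancel (X (Sum.inl i) : MvPolynomial (M.E ⊕ ProperFlat M) ℚ)
      (∑ F : ProperFlat M with (i : α) ∉ F.1, X (Sum.inr F)), add_mul, Finset.sum_mul]
    refine add_mem (Ideal.mul_mem_right _ _ hlin) (sum_mem fun F hF => ?_)
    have hiF : (i : α) ∉ F.1 := (Finset.mem_filter.1 hF).2
    -- A flat containing the other elements contains their closure, hence `i`.
    have : ¬ {i | ∃ j : M.E, Sum.inl j ∈ s ∧ (j : α) = i} \ {(i : α)} ⊆ F.1 := fun h =>
      hiF (F.2.1.closure ▸ M.closure_subset_closure h hcl)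
    obtain ⟨_, ⟨⟨j, hj, rfl⟩, hji⟩, hjF⟩ := Set.not_subset.1 this
    have hje : Sum.inl j ∈ s.erase (Sum.inl i) :=
      Finset.mem_erase.2 ⟨fun h => hji (congrArg Subtype.val (Sum.inl.inj h)), hj⟩
    refine Ideal.mem_of_dvd _ ?_ (Ideal.mem_sup_right
      (Ideal.subset_span (Or.inr ⟨j, F, hjF, rfl⟩)))
    rw [mul_comm]
    exact mul_dvd_mul_left _ (Finset.dvd_prod_of_mem _ hje)

theorem augChowI_sup_augChowJ :
    augChowI M ⊔ augChowJ M =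
      FanChow.presentationIdeal (lattice M) (augRay M) (augComplex M) := by
  apply le_antisymm
  · refine sup_le (Ideal.span_le.2 ?_) (Ideal.span_le.2 ?_)
    · rintro _ ⟨i, rfl⟩
      refine Ideal.subset_span (Or.inr ⟨_, ⟨LinearMap.proj i, proj_rat M i, rfl⟩,
        Sum.elim (fun k => if i = k then 1 else 0) (fun F => -(if (i : α) ∈ F.1 then 0 else 1)),
        ?_, ?_⟩)
      · rintro (k | F)
        · rw [LinearMap.proj_apply, augRay_inl_apply, Sum.elim_inl]
          split_ifs <;> simp
        · rw [LinearMap.proj_apply, augRay_inr_apply, Sum.elim_inr]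
          split_ifs <;> simp
      · rw [Fintype.sum_sum_type, sub_eq_add_neg, Finset.sum_filter, ← Finset.sum_neg_distrib]
        congr 1
        · simp
        · refine Finset.sum_congr rfl fun F _ => ?_
          by_cases h : (i : α) ∈ F.1 <;> simp [h]
    · rintro _ (⟨F, G, hFG, hGF, rfl⟩ | ⟨i, F, hiF, rfl⟩)
      · refine Ideal.subset_span (Or.inl ⟨{Sum.inr F, Sum.inr G}, fun h => ?_, ?_⟩)
        · exact (h.2.1 F G (by simp) (by simp)).elim hFG hGF
        · rw [Finset.prod_pair]
          rintro h
          rw [Sum.inr.inj h] at hFG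
          exact hFG subset_rfl
      · refine Ideal.subset_span (Or.inl ⟨{Sum.inl i, Sum.inr F}, fun h => ?_, ?_⟩)
        · exact hiF (h.2.2 i F (by simp) (by simp))
        · rw [Finset.prod_pair (by simp)]
  · refine Ideal.span_le.2 ?_
    rintro _ (⟨s, hs, rfl⟩ | ⟨_, ⟨l, hl, rfl⟩, q, hq, rfl⟩)
    · exact prod_mem_augChow_of_notMem M hs
    · refine Ideal.mem_sup_left ?_
      have hqF : ∀ F : ProperFlat M, q (Sum.inr F) =
          -∑ i : M.E, q (Sum.inl i) * (if (i : α) ∈ F.1 then 0 else 1) := by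
        refine fun F => Rat.cast_injective (α := ℝ) ?_
        rw [hq]
        change l (-e M (M.E \ F.1)) = _
        rw [map_neg, e_eq_sum, map_sum, Rat.cast_neg, Rat.cast_sum]
        congr 1
        refine Finset.sum_congr rfl fun i _ => ?_
        rw [map_smul, Rat.cast_mul, hq, smul_eq_mul, mul_comm]
        congr 1
        by_cases h : (i : α) ∈ F.1 <;> simp [h]
      -- A functional is determined by its values on the `e_i`, so its relation is the corresponding
      -- combination of those of the coordinates.
      have hp : ∑ j, C (q j) * X j = ∑ i : M.E, C (q (Sum.inl i)) *
          (X (Sum.inl i) - ∑ F : ProperFlat M with (i : α) ∉ F.1, X (Sum.inr F)) := by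
        rw [Fintype.sum_sum_type]
        simp only [mul_sub, Finset.sum_sub_distrib]
        rw [sub_eq_add_neg]
        congr 1
        simp only [hqF, map_neg, map_sum, Finset.mul_sum, Finset.sum_mul, neg_mul,
          Finset.sum_neg_distrib, Finset.sum_filter]
        rw [Finset.sum_comm]
        congr 1
        refine Finset.sum_congr rfl fun i _ => Finset.sum_congr rfl fun F _ => ?_
        by_cases h : (i : α) ∈ F.1 <;> simp [h]
      rw [hp]
      exact sum_mem fun i _ => Ideal.mul_mem_left _ _ (Ideal.subset_span ⟨i, rfl⟩)

end

/-! ### The two isomorphisms -/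

theorem t2Space_quotSpace : T2Space (QuotSpace M) := by
  have : IsClosed (Submodule.span ℝ {e M M.E} : Set (M.E → ℝ)) :=
    Submodule.closed_of_finiteDimensional _
  infer_instance

theorem exists_chowRing_equiv :
    ∃ φ : ChowRing M ≃ₐ[ℚ] FanChow.ChowRing (quotLattice M) (bergmanFan M),
      (∀ k : ℕ, (chowPiece M k).map φ.toLinearMap =
        FanChow.gradedPiece (quotLattice M) (bergmanFan M) k) ∧
      ∀ F : NonemptyProperFlat M, ∃ δ : FanChow.piecewisePoly (quotLattice M) (bergmanFan M),
        FanChow.IsCourant _ _ (ray M) F δ ∧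
          φ (toChow M (MvPolynomial.X F)) = FanChow.toChow _ _ δ := by
  have := t2Space_quotSpace M
  rw [bergmanFan_eq]
  exact (isUnimodular_bergmanFan M).exists_chowRing_equiv (chowI_sup_chowJ M)

theorem exists_augChowRing_equiv [M.Loopless] :
    ∃ ψ : AugChowRing M ≃ₐ[ℚ] FanChow.ChowRing (lattice M) (augBergmanFan M),
      (∀ k : ℕ, (augChowPiece M k).map ψ.toLinearMap =
        FanChow.gradedPiece (lattice M) (augBergmanFan M) k) ∧
      ∀ j : M.E ⊕ ProperFlat M, ∃ δ : FanChow.piecewisePoly (lattice M) (augBergmanFan M),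
        FanChow.IsCourant _ _ (augRay M) j δ ∧
          ψ (toAugChow M (MvPolynomial.X j)) = FanChow.toChow _ _ δ := by
  rw [augBergmanFan_eq]
  exact (isUnimodular_augBergmanFan M).exists_chowRing_equiv (augChowI_sup_augChowJ M)

end MatroidChow

end

theorem mainTheorem5 {α : Type*} (M : Matroid α) [M.Finite] [M.Loopless] :
    (∃ φ : MatroidChow.ChowRing M ≃ₐ[ℚ]
        FanChow.ChowRing (MatroidChow.quotLattice M) (MatroidChow.bergmanFan M),
      (∀ k : ℕ, (MatroidChow.chowPiece M k).map φ.toLinearMap =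
        FanChow.gradedPiece (MatroidChow.quotLattice M) (MatroidChow.bergmanFan M) k) ∧
      (∀ F : MatroidChow.NonemptyProperFlat M,
        ∃ δ : FanChow.piecewisePoly (MatroidChow.quotLattice M) (MatroidChow.bergmanFan M),
          FanChow.IsCourant _ _ (MatroidChow.ray M) F δ ∧
          φ (MatroidChow.toChow M (MvPolynomial.X F)) = FanChow.toChow _ _ δ)) ∧
    (∃ ψ : MatroidChow.AugChowRing M ≃ₐ[ℚ]
        FanChow.ChowRing (MatroidChow.lattice M) (MatroidChow.augBergmanFan M),
      (∀ k : ℕ, (MatroidChow.augChowPiece M k).map ψ.toLinearMap =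
        FanChow.gradedPiece (MatroidChow.lattice M) (MatroidChow.augBergmanFan M) k) ∧
      (∀ j : M.E ⊕ MatroidChow.ProperFlat M,
        ∃ δ : FanChow.piecewisePoly (MatroidChow.lattice M) (MatroidChow.augBergmanFan M),
          FanChow.IsCourant _ _ (MatroidChow.augRay M) j δ ∧
          ψ (MatroidChow.toAugChow M (MvPolynomial.X j)) = FanChow.toChow _ _ δ)) := by
  exact ⟨MatroidChow.exists_chowRing_equiv M, MatroidChow.exists_augChowRing_equiv M⟩
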